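/- Let $g\ge 0$, let $a_0<b_0<a_1<b_1<\dots<a_g<b_g$ be real numbers, let $D(x)=\prod_{i=0}^{g}(x-a_i)(x-b_i)$, and let $C_D$ be the completion of the affine curve $y^2=D(x)$ over $\mathbb C$ by two points $\infty_+$ and $\infty_-$, at which $y/x^{g+1}$ takes the values $1$ and $-1$ respectively (a totally real hyperelliptic curve of genus $g$). For real $t<0$ write $\sqrt t=i\sqrt{-t}$. Suppose that the Pell–Abel equation has a solution of degree $r$ on $C_D$: $f=P+yQ$ with monic polynomials $P,Q\in\mathbb C[x]$, $\deg P=r$, and $P^2-DQ^2=c$ for some $c\in\mathbb C^*$. Then there is a unique monic polynomial $R\in\mathbb R[x]$ of degree $g$ such that $$\int_{b_{j-1}}^{a_j}\frac{R(x)}{\sqrt{D(x)}}\,dx=0\qquad(j=1,\dots,g)$$ (these integrals are the real periods of the canonical differential $\eta=\frac{R(x)}{y}\,dx$ of $C_D$), and one has $$\frac{df}{f}=r\,\eta .$$ Moreover, with $\eta_j=\int_{a_j}^{b_j}\frac{R(x)}{\sqrt{D(x)}}\,dx$ for $j=0,\dots,g$: 1. on $C_D$, $\eta$ has exactly $2g$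 zeros, all simple, and exactly two poles, $\infty_+$ and $\infty_-$, both simple, with residues $-1$ and $+1$ respectively; 2. the $g$ real periods of $\eta$ vanish; 3. the numbers $r_j=r|\eta_j|/\pi$ $(0\le j\le g)$ are positive integers, and $\sum_{j=0}^{g}r_j=r$. All the integrals above converge absolutely. -/

import Mathlib

open Polynomial Filter Topology

noncomputable section

namespace PellAbel

variable {g : ℕ}

/-- The branch points are ordered as `a 0 < b 0 < a 1 < b 1 < ⋯ < a g < b g`. -/
def Ordered (a b : Fin (g + 1) → ℝ) : Prop :=
  (∀ j, a j < b j) ∧ ∀ j : Fin g, b j.castSucc < a j.succ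

/-- `D(x) = ∏ (x - a i) (x - b i)`, of degree `2 g + 2`. -/
def polyD (a b : Fin (g + 1) → ℝ) : ℝ[X] :=
  ∏ i, (X - C (a i)) * (X - C (b i))

/-- `D` as a polynomial with complex coefficients. -/
def polyDC (a b : Fin (g + 1) → ℝ) : ℂ[X] :=
  (polyD a b).map (algebraMap ℝ ℂ)

/-- `f = P + y Q` is a (normalised, nontrivial) solution of the Pell-Abel equation
`P ^ 2 - D Q ^ 2 = c`, with `c` a nonzero complex number and `P`, `Q` monic. -/
def IsSolution (a b : Fin (g + 1) → ℝ) (c : ℂ) (P Q : ℂ[X]) : Prop :=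
  c ≠ 0 ∧ P.Monic ∧ Q.Monic ∧ P ^ 2 - polyDC a b * Q ^ 2 = C c

/-! ### The completed curve and its local coordinates -/

/-- The points of the complete curve `C_D`: those of the affine curve `y ^ 2 = D(x)`, and two
points at infinity, where `y / x ^ (g + 1)` takes the values `1` and `-1` respectively. -/
inductive Curve (a b : Fin (g + 1) → ℝ) : Type
  | affine (x y : ℂ) (h : y ^ 2 = (polyDC a b).eval x) : Curve a b
  | inftyPlus : Curve a b
  | inftyMinus : Curve a b

/-- `t ↦ (x t, y t)`, for `t` near `0` in `ℂ`, parametrises a punctured neighbourhood of the point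
at infinity where `y / x ^ (g + 1) = ε`: in the coordinates `u = 1 / x`, `w = y / x ^ (g + 1)`, in
which the curve is smooth at `(u, w) = (0, ε)`, it extends to a holomorphic immersion. -/
def IsParamInfty (a b : Fin (g + 1) → ℝ) (ε : ℂ) (x y : ℂ → ℂ) : Prop :=
  ∃ u w : ℂ → ℂ, AnalyticAt ℂ u 0 ∧ AnalyticAt ℂ w 0 ∧ u 0 = 0 ∧ w 0 = ε ∧
    (deriv u 0 ≠ 0 ∨ deriv w 0 ≠ 0) ∧
    (∀ᶠ t in 𝓝 (0 : ℂ), w t ^ 2 = ∏ i, (1 - (a i : ℂ) * u t) * (1 - (b i : ℂ) * u t)) ∧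
    ∀ᶠ t in 𝓝[≠] (0 : ℂ), x t = 1 / u t ∧ y t = w t / u t ^ (g + 1)

/-- `t ↦ (x t, y t)` is a holomorphic local parametrisation of `C_D` centred at the given point
(so that `t` is a local coordinate there): a germ of holomorphic map to the (smooth) curve with
nonvanishing derivative and with the point as its value at `t = 0`. -/
def IsLocalParam {a b : Fin (g + 1) → ℝ} (x y : ℂ → ℂ) : Curve a b → Prop
  | .affine x₀ y₀ _ =>
      AnalyticAt ℂ x 0 ∧ AnalyticAt ℂ y 0 ∧ x 0 = x₀ ∧ y 0 = y₀ ∧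
        (deriv x 0 ≠ 0 ∨ deriv y 0 ≠ 0) ∧
        ∀ᶠ t in 𝓝 (0 : ℂ), y t ^ 2 = (polyDC a b).eval (x t)
  | .inftyPlus => IsParamInfty a b 1 x y
  | .inftyMinus => IsParamInfty a b (-1) x y

/-! ### Differentials on the curve

A differential `F(x, y) dx` on the curve is given by its coefficient `F`. -/

/-- The expression of `F(x, y) dx` in the local coordinate `t`: it is `pullback F x y t dt`. -/
def pullback (F : ℂ → ℂ → ℂ) (x y : ℂ → ℂ) (t : ℂ) : ℂ :=
  F (x t) (y t) * deriv x t

/-- `F(x, y) dx` is meromorphic at the point `p`, of order `n` (in every local coordinate): a zero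
of order `n` if `0 < n`, a pole of order `-n` if `n < 0`. -/
def HasOrderAt {a b : Fin (g + 1) → ℝ} (F : ℂ → ℂ → ℂ) (p : Curve a b) (n : ℤ) : Prop :=
  (∃ x y, IsLocalParam x y p) ∧
    ∀ x y, IsLocalParam x y p →
      MeromorphicAt (pullback F x y) 0 ∧
        meromorphicOrderAt (pullback F x y) 0 = (n : WithTop ℤ)

/-- `F(x, y) dx` has residue `ρ` at the point `p` (in every local coordinate): the integral over
every small circle around `p` is `2 π i ρ`. -/
def HasResidueAt {a b : Fin (g + 1) → ℝ} (F : ℂ → ℂ → ℂ) (p : Curve a b) (ρ : ℂ) : Prop :=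
  (∃ x y, IsLocalParam x y p) ∧
    ∀ x y, IsLocalParam x y p →
      ∀ᶠ s : ℝ in 𝓝[>] 0,
        (∮ t in C(0, s), pullback F x y t) = 2 * (Real.pi : ℂ) * Complex.I * ρ

/-- The equality `df / f = F(x, y) dx` of meromorphic differentials on the curve, for a function
`f = f(x, y)`: it holds in every local coordinate. -/
def DlogEq (a b : Fin (g + 1) → ℝ) (f F : ℂ → ℂ → ℂ) : Prop :=
  ∀ (p : Curve a b) (x y : ℂ → ℂ), IsLocalParam x y p →
    ∀ᶠ t in 𝓝[≠] (0 : ℂ),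
      deriv (fun s => f (x s) (y s)) t / f (x t) (y t) = pullback F x y t

/-- The coefficient of `η_A = (A(x) / y) dx`. -/
def eta (A : ℝ[X]) (x y : ℂ) : ℂ :=
  (A.map (algebraMap ℝ ℂ)).eval x / y

/-! ### Periods and the canonical differential -/

/-- The square root of a real number: the nonnegative one if `0 ≤ t`, and `i √(-t)` if `t < 0`. -/
def csqrt (t : ℝ) : ℂ :=
  if 0 ≤ t then (√t : ℂ) else Complex.I * (√(-t) : ℂ)

/-- The function `A(x) / √D(x)` of the real variable `x`. -/
def integrand (a b : Fin (g + 1) → ℝ) (A : ℝ[X]) (x : ℝ) : ℂ :=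
  ((A.eval x : ℝ) : ℂ) / csqrt ((polyD a b).eval x)

/-- The real periods of `η_A`, over the intervals `[b (j - 1), a j]` for `j = 1, …, g`. -/
def realPeriod (a b : Fin (g + 1) → ℝ) (A : ℝ[X]) (j : Fin g) : ℂ :=
  ∫ x in (b j.castSucc)..(a j.succ), integrand a b A x

/-- The imaginary half-periods `η_j` of `η_A`, over the intervals `[a j, b j]`. -/
def imagHalfPeriod (a b : Fin (g + 1) → ℝ) (A : ℝ[X]) (j : Fin (g + 1)) : ℂ :=
  ∫ x in (a j)..(b j), integrand a b A x

/-- `R` is the canonical polynomial of `C_D`: real, monic of degree `g`, and the real periods of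
`η_R` vanish. The canonical differential is then `η_R = (R(x) / y) dx`. -/
def IsCanonical (a b : Fin (g + 1) → ℝ) (R : ℝ[X]) : Prop :=
  R.Monic ∧ R.natDegree = g ∧ ∀ j, realPeriod a b R j = 0

end PellAbel

end

/-!
Write `f = P + y Q` and `D = polyD a b`. Differentiating `P ^ 2 - D Q ^ 2 = c` shows that `Q`
divides `P'`, and yields `df / f = r (S / y) dx` with a complex monic polynomial `S` of degree `g`
(`IsSolution.exists_derivative_eq`, `IsSolution.dlogEq`). It remains to see that `S` is the
canonical polynomial, and to count.

On the closed upper half-plane `D` has a continuous square root `sqrtD`, and `f = P + √D Q` does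
not vanish there, as `f (P - √D Q) = c`. Hence `f` has a continuous logarithm `L`. On the real
line off the branch points `L' = r S / √D`, so `r ∫ S / √D` over an interval between consecutive
branch points is a difference of values of `L`; it lies in `π i ℤ` because `f ^ 2 = c` at the
branch points. Write `S = A + i B` with `A` and `B` real. In the gaps `√D` is real, and taking
real parts shows that the real periods of `A` vanish. On the bands `√D` is imaginary, and real
parts show that `∫ B / √|D| = 0`; so `B`, of degree at most `g`, has a zero in each of the `g + 1`
bands and is zero (`IsSolution.exists_canonical`). A vanishing integral forces a zero in the same
way in every gap: this gives uniqueness of the canonical polynomial `R` and one simple zero of `R`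
in each gap, from which the divisor of `η` is read off in local parameters.

Both `√D` and `R` change sign from one band to the next, so on every band `L` changes by
`-i r |η_j|`. Over the gaps `L` does not change, over the two outer half-lines its imaginary part
does not, and over a large half-circle the imaginary part grows by `π r` because `f ∼ 2 x ^ r`
(`IsSolution.tendsto_log_sub`). Since `L` is single-valued, the `r |η_j|` add up to `π r`
(`IsSolution.exists_natCast_eq`).
-/

namespace PellAbel

variable {g : ℕ} {a b : Fin (g + 1) → ℝ}

/-! ### The branch points and the polynomial `D` -/

theorem Ordered.b_lt_a (h : Ordered a b) {i j : Fin (g + 1)} (hij : i < j) : b i < a j := by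
  have hmono : StrictMono b := Fin.strictMono_iff_lt_succ.2 fun k => (h.2 k).trans (h.1 _)
  obtain ⟨k, rfl⟩ := Fin.exists_succ_eq.2 (Fin.ne_zero_of_lt hij)
  exact (hmono.monotone (Fin.le_castSucc_iff.2 hij)).trans_lt (h.2 k)

theorem Ordered.strictMono_a (h : Ordered a b) : StrictMono a := fun i _ hij =>
  (h.1 i).trans (h.b_lt_a hij)

theorem Ordered.strictMono_b (h : Ordered a b) : StrictMono b := fun _ j hij =>
  (h.b_lt_a hij).trans (h.1 j)

theorem Ordered.injective_elim (h : Ordered a b) : Function.Injective (Sum.elim a b) := by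
  refine h.strictMono_a.injective.sumElim h.strictMono_b.injective fun i j => ?_
  rcases le_or_gt i j with hij | hij
  · exact ((h.strictMono_a.monotone hij).trans_lt (h.1 j)).ne
  · exact (h.b_lt_a hij).ne'

theorem polyD_eq_prod_sum (a b : Fin (g + 1) → ℝ) :
    polyD a b = ∏ k, (X - C (Sum.elim a b k)) := by
  simp [polyD, Fintype.prod_sum_type, Finset.prod_mul_distrib]

theorem monic_polyD (a b : Fin (g + 1) → ℝ) : (polyD a b).Monic := by
  rw [polyD_eq_prod_sum]
  exact monic_prod_of_monic _ _ fun _ _ => monic_X_sub_C _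

theorem natDegree_polyD (a b : Fin (g + 1) → ℝ) : (polyD a b).natDegree = 2 * (g + 1) := by
  rw [polyD_eq_prod_sum, natDegree_prod_of_monic _ _ fun _ _ => monic_X_sub_C _]
  simp
  ring

theorem Ordered.separable_polyD (h : Ordered a b) : (polyD a b).Separable := by
  rw [polyD_eq_prod_sum]
  exact separable_prod_X_sub_C_iff.2 h.injective_elim

theorem Ordered.eval_derivative_polyDC_ne_zero (h : Ordered a b) {x : ℂ}
    (hx : (polyDC a b).eval x = 0) : (polyDC a b).derivative.eval x ≠ 0 :=
  Separable.eval₂_derivative_ne_zero (RingHom.id ℂ)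
    (Separable.map (f := algebraMap ℝ ℂ) h.separable_polyD) hx

theorem eval_polyD (a b : Fin (g + 1) → ℝ) (x : ℝ) :
    (polyD a b).eval x = ∏ i, (x - a i) * (x - b i) := by
  simp [polyD, eval_prod]

theorem eval_polyDC (a b : Fin (g + 1) → ℝ) (x : ℂ) :
    (polyDC a b).eval x = ∏ i, (x - a i) * (x - b i) := by
  simp [polyDC, polyD, Polynomial.map_prod, eval_prod]

theorem eval_map_ofReal (p : ℝ[X]) (x : ℝ) :
    (p.map (algebraMap ℝ ℂ)).eval (x : ℂ) = ((p.eval x : ℝ) : ℂ) := by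
  rw [eval_map_algebraMap]
  exact Polynomial.aeval_algebraMap_apply ℂ x p

theorem eval_polyDC_ofReal (a b : Fin (g + 1) → ℝ) (x : ℝ) :
    (polyDC a b).eval (x : ℂ) = (((polyD a b).eval x : ℝ) : ℂ) :=
  eval_map_ofReal _ _

theorem eval_polyD_a (a b : Fin (g + 1) → ℝ) (j : Fin (g + 1)) : (polyD a b).eval (a j) = 0 := by
  rw [eval_polyD]
  exact Finset.prod_eq_zero (Finset.mem_univ j) (by simp)

theorem eval_polyD_b (a b : Fin (g + 1) → ℝ) (j : Fin (g + 1)) : (polyD a b).eval (b j) = 0 := by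
  rw [eval_polyD]
  exact Finset.prod_eq_zero (Finset.mem_univ j) (by simp)

theorem Ordered.eval_polyD_neg (h : Ordered a b) {j : Fin (g + 1)} {x : ℝ}
    (hx : x ∈ Set.Ioo (a j) (b j)) : (polyD a b).eval x < 0 := by
  rw [eval_polyD, Fin.prod_univ_succAbove _ j]
  refine mul_neg_of_neg_of_pos
    (mul_neg_of_pos_of_neg (sub_pos.2 hx.1) (sub_neg.2 hx.2)) (Finset.prod_pos fun i _ => ?_)
  rcases lt_or_gt_of_ne (Fin.succAbove_ne j i) with hi | hi
  · have := h.b_lt_a hi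
    have := h.1 (j.succAbove i)
    exact mul_pos (by linarith [hx.1]) (by linarith [hx.1])
  · have := h.b_lt_a hi
    have := h.1 (j.succAbove i)
    exact mul_pos_of_neg_of_neg (by linarith [hx.2]) (by linarith [hx.2])

theorem Ordered.eval_polyD_pos (h : Ordered a b) {j : Fin g} {x : ℝ}
    (hx : x ∈ Set.Ioo (b j.castSucc) (a j.succ)) : 0 < (polyD a b).eval x := by
  rw [eval_polyD]
  refine Finset.prod_pos fun i _ => ?_
  have := h.1 i
  rcases le_or_gt i j.castSucc with hi | hi
  · have := h.strictMono_b.monotone hi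
    exact mul_pos (by linarith [hx.1]) (by linarith [hx.1])
  · have := h.strictMono_a.monotone (Fin.castSucc_lt_iff_succ_le.1 hi)
    exact mul_pos_of_neg_of_neg (by linarith [hx.2]) (by linarith [hx.2])

theorem Ordered.eval_polyD_pos_of_lt (h : Ordered a b) {x : ℝ} (hx : x < a 0) :
    0 < (polyD a b).eval x := by
  rw [eval_polyD]
  refine Finset.prod_pos fun i _ => ?_
  have := h.1 i
  have := h.strictMono_a.monotone (Fin.zero_le i)
  exact mul_pos_of_neg_of_neg (by linarith) (by linarith)

theorem Ordered.eval_polyD_pos_of_gt (h : Ordered a b) {x : ℝ} (hx : b (Fin.last g) < x) :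
    0 < (polyD a b).eval x := by
  rw [eval_polyD]
  refine Finset.prod_pos fun i _ => ?_
  have := h.1 i
  have := h.strictMono_b.monotone (Fin.le_last i)
  exact mul_pos (by linarith) (by linarith)

/-! ### The logarithmic derivative of a solution -/

theorem IsSolution.natDegree_eq {c : ℂ} {P Q : ℂ[X]} (h : IsSolution a b c P Q) :
    P.natDegree = Q.natDegree + (g + 1) := by
  obtain ⟨-, hP, hQ, e⟩ := h
  have hD : (polyDC a b).Monic := (monic_polyD a b).map _
  have hDd : (polyDC a b).natDegree = 2 * (g + 1) := by
    rw [polyDC, (monic_polyD a b).natDegree_map, natDegree_polyD]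
  have h1 : polyDC a b * Q ^ 2 = P ^ 2 - C c := by rw [← e]; ring
  have h2 := congrArg natDegree h1
  rw [natDegree_sub_C, hD.natDegree_mul (hQ.pow 2), hQ.natDegree_pow, hP.natDegree_pow, hDd] at h2
  omega

theorem IsSolution.isCoprime {c : ℂ} {P Q : ℂ[X]} (h : IsSolution a b c P Q) : IsCoprime P Q := by
  obtain ⟨hc, -, -, e⟩ := h
  refine ⟨C c⁻¹ * P, -(C c⁻¹ * polyDC a b * Q), ?_⟩
  have : C c⁻¹ * (P ^ 2 - polyDC a b * Q ^ 2) = 1 := by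
    rw [e, ← C_mul, inv_mul_cancel₀ hc, C_1]
  linear_combination this

/-- The polynomial identities behind `df / f = r (S / y) dx`: as `P` and `Q` are coprime,
differentiating the Pell-Abel equation shows that `Q` divides `P'`. -/
theorem IsSolution.exists_derivative_eq {c : ℂ} {P Q : ℂ[X]} (h : IsSolution a b c P Q) :
    ∃ S : ℂ[X], S.Monic ∧ S.natDegree = g ∧ derivative P = C (P.natDegree : ℂ) * (Q * S) ∧
      2 * C (P.natDegree : ℂ) * (P * S) =
        derivative (polyDC a b) * Q + 2 * polyDC a b * derivative Q := by
  have hdeg := h.natDegree_eq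
  have hcop := h.isCoprime
  obtain ⟨hc, hP, hQ, e⟩ := h
  have hr : (P.natDegree : ℂ) ≠ 0 := Nat.cast_ne_zero.2 (by omega)
  have hd : 2 * (P * derivative P) =
      Q * (derivative (polyDC a b) * Q + 2 * polyDC a b * derivative Q) := by
    have := congrArg derivative e
    simp only [derivative_sub, derivative_mul, derivative_pow, derivative_C, Nat.cast_ofNat,
      Nat.add_one_sub_one, pow_one, map_ofNat] at this
    linear_combination this
  have hdvd : Q ∣ derivative P := by
    have h3 : Q ∣ P * derivative P := by
      have h4 : Q ∣ C 2⁻¹ * (2 * (P * derivative P)) := by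
        rw [hd]; exact (Dvd.intro _ rfl).mul_left _
      rwa [← mul_assoc, ← C_ofNat (R := ℂ) (n := 2), ← C_mul, inv_mul_cancel₀ two_ne_zero, C_1,
        one_mul] at h4
    exact hcop.symm.dvd_of_dvd_mul_left h3
  obtain ⟨T, hT⟩ := hdvd
  have hlead : (derivative P).leadingCoeff = P.natDegree := by
    rw [leadingCoeff_derivative, hP.leadingCoeff, one_mul]
  have hTl : T.leadingCoeff = P.natDegree := by
    rw [← hlead, hT, leadingCoeff_mul, hQ.leadingCoeff, one_mul]
  have hT0 : T ≠ 0 := by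
    rintro rfl
    simp at hTl
    exact hr (by exact_mod_cast hTl.symm)
  have hTd : T.natDegree = g := by
    have := congrArg natDegree hT
    rw [natDegree_derivative, natDegree_mul hQ.ne_zero hT0] at this
    omega
  have hCT : C (P.natDegree : ℂ) * (C (P.natDegree : ℂ)⁻¹ * T) = T := by
    rw [← mul_assoc, ← C_mul, mul_inv_cancel₀ hr, C_1, one_mul]
  refine ⟨C (P.natDegree : ℂ)⁻¹ * T, ?_, ?_, ?_, ?_⟩
  · rw [Monic, leadingCoeff_mul, leadingCoeff_C, hTl, inv_mul_cancel₀ hr]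
  · rw [natDegree_C_mul (inv_ne_zero hr), hTd]
  · rw [hT]; linear_combination -Q * hCT
  · refine mul_left_cancel₀ hQ.ne_zero ?_
    rw [← hd, hT]
    linear_combination (2 * P * Q) * hCT

/-! ### Local parametrisations of the curve -/

theorem analyticAt_eval {x : ℂ → ℂ} {t : ℂ} (hx : AnalyticAt ℂ x t) (p : ℂ[X]) :
    AnalyticAt ℂ (fun s => p.eval (x s)) t := by
  simpa using hx.aeval_polynomial p

theorem exists_analytic_sqrt {h : ℂ → ℂ} (hh : AnalyticAt ℂ h 0) {w₀ : ℂ} (hw₀ : w₀ ≠ 0)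
    (e : w₀ ^ 2 = h 0) :
    ∃ w : ℂ → ℂ, AnalyticAt ℂ w 0 ∧ w 0 = w₀ ∧ ∀ t, w t ^ 2 = h t := by
  have h2 : w₀ ^ 2 ≠ 0 := pow_ne_zero 2 hw₀
  refine ⟨fun t => w₀ * (h t / w₀ ^ 2) ^ ((2 : ℕ) : ℂ)⁻¹, ?_, ?_, fun t => ?_⟩
  · refine analyticAt_const.mul ((hh.div analyticAt_const h2).cpow analyticAt_const ?_)
    simp [← e, div_self h2]
  · simp [← e, div_self h2]
  · rw [mul_pow, Complex.cpow_nat_inv_pow _ two_ne_zero, mul_div_cancel₀ _ h2]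

theorem exists_isLocalParam_affine (x₀ y₀ : ℂ) (h : y₀ ^ 2 = (polyDC a b).eval x₀)
    (hab : Ordered a b) : ∃ x y, IsLocalParam x y (.affine x₀ y₀ h : Curve a b) := by
  by_cases hy : y₀ = 0
  · -- At a branch point `D = (X - x₀) E` with `E(x₀) ≠ 0`: put `x = x₀ + t ^ 2`, `y = t √E(x)`.
    have hx : (polyDC a b).eval x₀ = 0 := by rw [← h, hy]; simp
    obtain ⟨E, hE⟩ := dvd_iff_isRoot.2 hx
    have hE0 : E.eval x₀ ≠ 0 := by
      have := hab.eval_derivative_polyDC_ne_zero hx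
      rw [hE] at this
      simpa using this
    obtain ⟨s, hs⟩ := IsSquare.exists_sq _ (IsAlgClosed.exists_eq_mul_self (E.eval x₀))
    have hs0 : s ≠ 0 := by rintro rfl; exact hE0 (by simpa using hs)
    have hX : AnalyticAt ℂ (fun t : ℂ => x₀ + t ^ 2) 0 := by fun_prop
    obtain ⟨w, hw, hw0, hw2⟩ := exists_analytic_sqrt (analyticAt_eval hX E) hs0
      (by simp [hs])
    refine ⟨fun t => x₀ + t ^ 2, fun t => t * w t, hX, analyticAt_id.mul hw, by simp,
      by simp [hy], Or.inr ?_, .of_forall fun t => ?_⟩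
    · have := (hasDerivAt_id (0 : ℂ)).mul hw.differentiableAt.hasDerivAt
      simp only [id, one_mul, zero_mul, add_zero, hw0] at this
      exact this.deriv.trans_ne hs0
    · rw [hE, mul_pow, hw2]
      simp
  · have hX : AnalyticAt ℂ (fun t : ℂ => x₀ + t) 0 := by fun_prop
    obtain ⟨w, hw, hw0, hw2⟩ := exists_analytic_sqrt (analyticAt_eval hX (polyDC a b)) hy
      (by simp [h])
    exact ⟨fun t => x₀ + t, w, hX, hw, by simp, hw0, Or.inl (by simp), .of_forall hw2⟩

theorem exists_isParamInfty {ε : ℂ} (hε : ε ^ 2 = 1) (a b : Fin (g + 1) → ℝ) :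
    ∃ x y, IsParamInfty a b ε x y := by
  have hε0 : ε ≠ 0 := by rintro rfl; simp at hε
  have hK : AnalyticAt ℂ
      (fun t : ℂ => ∏ i, (1 - (a i : ℂ) * t) * (1 - (b i : ℂ) * t)) 0 := by fun_prop
  obtain ⟨w, hw, hw0, hw2⟩ := exists_analytic_sqrt hK hε0 (by simp [hε])
  exact ⟨fun t => 1 / t, fun t => w t / t ^ (g + 1), fun t => t, w, analyticAt_id, hw, rfl, hw0,
    Or.inl (by simp), .of_forall hw2, .of_forall fun t => ⟨rfl, rfl⟩⟩

theorem two_mul_deriv_of_sq_eq {x y : ℂ → ℂ} {t : ℂ} {p : ℂ[X]} (hx : DifferentiableAt ℂ x t)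
    (hy : DifferentiableAt ℂ y t) (h : ∀ᶠ s in 𝓝 t, y s ^ 2 = p.eval (x s)) :
    2 * y t * deriv y t = p.derivative.eval (x t) * deriv x t := by
  have h1 := hy.hasDerivAt.pow 2
  have h2 := (p.hasDerivAt (x t)).comp t hx.hasDerivAt
  have h3 := h1.unique (h2.congr_of_eventuallyEq h)
  simpa using h3

/-- Both coordinates of a local parametrisation at a finite point are regular, and `y` does not
vanish off the centre. -/
theorem IsLocalParam.eventually_affine {x₀ y₀ : ℂ} {h : y₀ ^ 2 = (polyDC a b).eval x₀}
    {x y : ℂ → ℂ} (hp : IsLocalParam x y (.affine x₀ y₀ h : Curve a b)) (hab : Ordered a b) :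
    ∀ᶠ t in 𝓝[≠] (0 : ℂ), DifferentiableAt ℂ x t ∧ DifferentiableAt ℂ y t ∧ y t ≠ 0 ∧
      ∀ᶠ s in 𝓝 t, y s ^ 2 = (polyDC a b).eval (x s) := by
  obtain ⟨hx, hy, hx0, hy0, hd, he⟩ := hp
  have hyne : ∀ᶠ t in 𝓝[≠] (0 : ℂ), y t ≠ 0 := by
    by_cases hy0' : y₀ = 0
    · have h2 := two_mul_deriv_of_sq_eq hx.differentiableAt hy.differentiableAt he
      have h3 : (polyDC a b).derivative.eval (x 0) ≠ 0 :=
        hab.eval_derivative_polyDC_ne_zero (by rw [hx0, ← h, hy0']; simp)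
      have h4 : deriv x 0 = 0 := by
        rw [hy0, hy0', mul_zero, zero_mul] at h2
        exact (mul_eq_zero.1 h2.symm).resolve_left h3
      exact hy.differentiableAt.hasDerivAt.eventually_ne (hd.resolve_left (not_not.2 h4))
    · exact (hy.continuousAt.eventually_ne (by rwa [hy0])).filter_mono nhdsWithin_le_nhds
  filter_upwards [hyne, hx.eventually_analyticAt.filter_mono nhdsWithin_le_nhds,
    hy.eventually_analyticAt.filter_mono nhdsWithin_le_nhds,
    he.eventually_nhds.filter_mono nhdsWithin_le_nhds] with t h1 h2 h3 h4
  exact ⟨h2.differentiableAt, h3.differentiableAt, h1, h4⟩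

/-- Data of a local parametrisation at infinity: `u = 1 / x` vanishes to first order, so it is a
local coordinate. -/
theorem IsParamInfty.exists_data {ε : ℂ} (hε : ε ^ 2 = 1) {x y : ℂ → ℂ}
    (hp : IsParamInfty a b ε x y) :
    ∃ u w : ℂ → ℂ, AnalyticAt ℂ u 0 ∧ AnalyticAt ℂ w 0 ∧ u 0 = 0 ∧ w 0 = ε ∧ deriv u 0 ≠ 0 ∧
      ∀ᶠ t in 𝓝[≠] (0 : ℂ), DifferentiableAt ℂ u t ∧ DifferentiableAt ℂ w t ∧ u t ≠ 0 ∧ w t ≠ 0 ∧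
        (∀ᶠ s in 𝓝 t, x s = 1 / u s) ∧ (∀ᶠ s in 𝓝 t, y s = w s / u s ^ (g + 1)) ∧
        ∀ᶠ s in 𝓝 t, w s ^ 2 = ∏ i, (1 - (a i : ℂ) * u s) * (1 - (b i : ℂ) * u s) := by
  obtain ⟨u, w, hu, hw, hu0, hw0, hd, he, hxy⟩ := hp
  have hε0 : ε ≠ 0 := by rintro rfl; simp at hε
  have hud : deriv u 0 ≠ 0 := by
    intro h0
    have h2 := two_mul_deriv_of_sq_eq hu.differentiableAt hw.differentiableAt
      (p := ∏ i, (1 - C (a i : ℂ) * X) * (1 - C (b i : ℂ) * X))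
      (he.mono fun s hs => by simpa [eval_prod] using hs)
    rw [h0, mul_zero, hw0] at h2
    have h3 : deriv w 0 = 0 := by simpa [hε0] using h2
    exact hd.elim (· h0) (· h3)
  refine ⟨u, w, hu, hw, hu0, hw0, hud, ?_⟩
  have hune : ∀ᶠ t in 𝓝[≠] (0 : ℂ), u t ≠ 0 :=
    hu.differentiableAt.hasDerivAt.eventually_ne (c := 0) hud
  have hwne : ∀ᶠ t in 𝓝[≠] (0 : ℂ), w t ≠ 0 :=
    (hw.continuousAt.eventually_ne (by rwa [hw0])).filter_mono nhdsWithin_le_nhds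
  have hxy' : ∀ᶠ t in 𝓝[≠] (0 : ℂ), ∀ᶠ s in 𝓝 t, x s = 1 / u s ∧ y s = w s / u s ^ (g + 1) := by
    filter_upwards [eventually_eventually_nhdsWithin.2 hxy, self_mem_nhdsWithin] with t ht ht0
    rwa [IsOpen.nhdsWithin_eq isOpen_compl_singleton ht0] at ht
  filter_upwards [hune, hwne, hu.eventually_analyticAt.filter_mono nhdsWithin_le_nhds,
    hw.eventually_analyticAt.filter_mono nhdsWithin_le_nhds,
    he.eventually_nhds.filter_mono nhdsWithin_le_nhds, hxy'] with t h1 h2 h3 h4 h5 h6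
  exact ⟨h3.differentiableAt, h4.differentiableAt, h1, h2, h6.mono fun _ h => h.1,
    h6.mono fun _ h => h.2, h5⟩

theorem sq_eq_of_infty {u w : ℂ} (hu : u ≠ 0)
    (h : w ^ 2 = ∏ i, (1 - (a i : ℂ) * u) * (1 - (b i : ℂ) * u)) :
    (w / u ^ (g + 1)) ^ 2 = (polyDC a b).eval (1 / u) := by
  have : (u ^ (g + 1)) ^ 2 = ∏ _i : Fin (g + 1), u * u := by
    rw [Finset.prod_const, Finset.card_univ, Fintype.card_fin]; ring
  rw [div_pow, h, eval_polyDC, this, ← Finset.prod_div_distrib]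
  refine Finset.prod_congr rfl fun i _ => ?_
  field_simp

theorem IsParamInfty.eventually {ε : ℂ} (hε : ε ^ 2 = 1) {x y : ℂ → ℂ}
    (hp : IsParamInfty a b ε x y) :
    ∀ᶠ t in 𝓝[≠] (0 : ℂ), DifferentiableAt ℂ x t ∧ DifferentiableAt ℂ y t ∧ y t ≠ 0 ∧
      ∀ᶠ s in 𝓝 t, y s ^ 2 = (polyDC a b).eval (x s) := by
  obtain ⟨u, w, -, -, -, -, -, h⟩ := hp.exists_data hε
  filter_upwards [h] with t ⟨hu, hw, hu0, hw0, hx, hy, he⟩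
  refine ⟨((differentiableAt_const 1).div hu hu0).congr_of_eventuallyEq hx,
    (hw.div (hu.pow _) (pow_ne_zero _ hu0)).congr_of_eventuallyEq hy, ?_, ?_⟩
  · rw [hy.self_of_nhds]
    exact div_ne_zero hw0 (pow_ne_zero _ hu0)
  · filter_upwards [hx, hy, he, hu.continuousAt.eventually_ne hu0] with s hx hy he hu0
    rw [hx, hy, sq_eq_of_infty hu0 he]

/-! ### The equality of differentials -/

theorem IsSolution.dlogEq {c : ℂ} {P Q : ℂ[X]} (h : IsSolution a b c P Q) (hab : Ordered a b)
    {R : ℝ[X]} (hR : 2 * C (P.natDegree : ℂ) * (P * R.map (algebraMap ℝ ℂ)) =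
        derivative (polyDC a b) * Q + 2 * polyDC a b * derivative Q)
    (hP : derivative P = C (P.natDegree : ℂ) * (Q * R.map (algebraMap ℝ ℂ))) :
    DlogEq a b (fun x y => P.eval x + y * Q.eval x)
      (fun x y => (P.natDegree : ℂ) * eta R x y) := by
  intro p x y hp
  have key : ∀ᶠ t in 𝓝[≠] (0 : ℂ), DifferentiableAt ℂ x t ∧ DifferentiableAt ℂ y t ∧ y t ≠ 0 ∧
      ∀ᶠ s in 𝓝 t, y s ^ 2 = (polyDC a b).eval (x s) := by
    cases p with
    | affine x₀ y₀ h₀ => exact hp.eventually_affine hab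
    | inftyPlus => exact IsParamInfty.eventually (by norm_num) hp
    | inftyMinus => exact IsParamInfty.eventually (by norm_num) hp
  filter_upwards [key] with t ⟨hx, hy, hy0, he⟩
  have hd := two_mul_deriv_of_sq_eq hx hy he
  have he0 := he.self_of_nhds
  have hf : HasDerivAt (fun s => P.eval (x s) + y s * Q.eval (x s))
      (P.derivative.eval (x t) * deriv x t +
        (deriv y t * Q.eval (x t) + y t * (Q.derivative.eval (x t) * deriv x t))) t :=
    ((P.hasDerivAt (x t)).comp t hx.hasDerivAt).add
      (hy.hasDerivAt.mul ((Q.hasDerivAt (x t)).comp t hx.hasDerivAt))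
  have hnorm : (P.eval (x t) + y t * Q.eval (x t)) * (P.eval (x t) - y t * Q.eval (x t)) = c := by
    have := congrArg (eval (x t)) h.2.2.2
    simp only [eval_sub, eval_mul, eval_pow, eval_C] at this
    linear_combination this - Q.eval (x t) ^ 2 * he0
  have hf0 : P.eval (x t) + y t * Q.eval (x t) ≠ 0 := fun h0 =>
    h.1 (by rw [← hnorm, h0, zero_mul])
  have hR' := congrArg (eval (x t)) hR
  have hP' := congrArg (eval (x t)) hP
  simp only [eval_mul, eval_add, eval_C, eval_ofNat] at hR' hP'
  rw [hf.deriv, pullback, eta, div_eq_iff hf0, hP']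
  field_simp
  refine mul_left_cancel₀ (two_ne_zero (α := ℂ)) ?_
  linear_combination Q.eval (x t) * hd - deriv x t * hR' +
    2 * Q.derivative.eval (x t) * deriv x t * he0

/-! ### Orders and residues of `η` -/

theorem meromorphicOrderAt_eq_of_eventuallyEq {F h : ℂ → ℂ} {n : ℤ} (hh : AnalyticAt ℂ h 0)
    (h0 : h 0 ≠ 0) (e : ∀ᶠ t in 𝓝[≠] (0 : ℂ), F t = t ^ n * h t) :
    MeromorphicAt F 0 ∧ meromorphicOrderAt F 0 = (n : WithTop ℤ) := by
  have hm : MeromorphicAt F 0 :=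
    (((MeromorphicAt.id 0).zpow n).mul hh.meromorphicAt).congr (by
      filter_upwards [e] with t ht using by simp [ht])
  exact ⟨hm, (meromorphicOrderAt_eq_int_iff hm).2 ⟨h, hh, h0, by simpa using e⟩⟩

theorem exists_eq_mul_of_deriv_ne_zero {u : ℂ → ℂ} (hu : AnalyticAt ℂ u 0) (hu0 : u 0 = 0)
    (hd : deriv u 0 ≠ 0) :
    ∃ v : ℂ → ℂ, AnalyticAt ℂ v 0 ∧ v 0 = deriv u 0 ∧ ∀ᶠ t in 𝓝 (0 : ℂ), u t = t * v t := by
  obtain ⟨v, hv, -, he⟩ := (hu.analyticOrderAt_eq_natCast (n := 1)).1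
    (by exact_mod_cast hu.analyticOrderAt_eq_one_of_zero_deriv_ne_zero hu0 hd)
  have he' : ∀ᶠ t in 𝓝 (0 : ℂ), u t = t * v t := by simpa using he
  refine ⟨v, hv, ?_, he'⟩
  have h1 := ((hasDerivAt_id (0 : ℂ)).mul hv.differentiableAt.hasDerivAt).congr_of_eventuallyEq he'
  simp only [id, one_mul, zero_mul, add_zero] at h1
  exact h1.deriv.symm

theorem hasOrderAt_affine_of_ne_zero (hab : Ordered a b) {R : ℝ[X]} {x₀ y₀ : ℂ}
    (h : y₀ ^ 2 = (polyDC a b).eval x₀) (hy₀ : y₀ ≠ 0) {k : ℕ} {E : ℂ[X]} (hE : E.eval x₀ ≠ 0)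
    (hR : R.map (algebraMap ℝ ℂ) = (X - C x₀) ^ k * E) :
    HasOrderAt (eta R) (.affine x₀ y₀ h : Curve a b) k := by
  refine ⟨exists_isLocalParam_affine x₀ y₀ h hab, fun x y hp => ?_⟩
  obtain ⟨hx, hy, hx0, hy0, hd, he⟩ := hp
  have hxd : deriv x 0 ≠ 0 := by
    intro h0
    have h2 := two_mul_deriv_of_sq_eq hx.differentiableAt hy.differentiableAt he
    rw [h0, mul_zero, hy0] at h2
    have h3 : deriv y 0 = 0 := by simpa [hy₀] using h2
    exact hd.elim (· h0) (· h3)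
  obtain ⟨v, hv, hv0, hve⟩ := exists_eq_mul_of_deriv_ne_zero (u := fun t => x t - x₀)
    (hx.sub analyticAt_const) (by simp [hx0]) (by simpa using hxd)
  refine meromorphicOrderAt_eq_of_eventuallyEq
    (h := fun t => v t ^ k * E.eval (x t) / y t * deriv x t)
    ((((hv.pow k).mul (analyticAt_eval hx E)).div hy (by rwa [hy0])).mul hx.deriv) ?_ ?_
  · simp only [deriv_sub_const] at hv0
    simp only [hx0, hy0, hv0]
    exact mul_ne_zero (div_ne_zero (mul_ne_zero (pow_ne_zero _ hxd) hE) hy₀) hxd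
  · filter_upwards [hve.filter_mono nhdsWithin_le_nhds] with t ht
    rw [pullback, eta, hR]
    simp only [eval_mul, eval_pow, eval_sub, eval_X, eval_C, ht, zpow_natCast]
    ring

/-- At a branch point `dx / y = 2 dy / D'(x)` is regular and does not vanish. -/
theorem hasOrderAt_affine_zero (hab : Ordered a b) {R : ℝ[X]} {x₀ y₀ : ℂ}
    (h : y₀ ^ 2 = (polyDC a b).eval x₀) (hy₀ : y₀ = 0)
    (hR : (R.map (algebraMap ℝ ℂ)).eval x₀ ≠ 0) :
    HasOrderAt (eta R) (.affine x₀ y₀ h : Curve a b) 0 := by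
  refine ⟨exists_isLocalParam_affine x₀ y₀ h hab, fun x y hp => ?_⟩
  have hev := hp.eventually_affine hab
  obtain ⟨hx, hy, hx0, hy0, hd, he⟩ := hp
  have hD0 : (polyDC a b).derivative.eval (x 0) ≠ 0 :=
    hab.eval_derivative_polyDC_ne_zero (by rw [hx0, ← h, hy₀]; simp)
  have hyd : deriv y 0 ≠ 0 := by
    have h2 := two_mul_deriv_of_sq_eq hx.differentiableAt hy.differentiableAt he
    rw [hy0, hy₀, mul_zero, zero_mul] at h2
    exact hd.resolve_left (not_not.2 ((mul_eq_zero.1 h2.symm).resolve_left hD0))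
  refine meromorphicOrderAt_eq_of_eventuallyEq
    (h := fun t => (R.map (algebraMap ℝ ℂ)).eval (x t) *
      (2 * deriv y t / (polyDC a b).derivative.eval (x t)))
    ((analyticAt_eval hx _).mul ((analyticAt_const.mul hy.deriv).div (analyticAt_eval hx _) hD0))
    ?_ ?_
  · rw [hx0] at hD0 ⊢
    exact mul_ne_zero hR (div_ne_zero (mul_ne_zero two_ne_zero hyd) hD0)
  · filter_upwards [hev, (analyticAt_eval hx (polyDC a b).derivative).continuousAt.eventually_ne hD0
      |>.filter_mono nhdsWithin_le_nhds] with t ⟨hxt, hyt, hyt0, het⟩ hDt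
    have h2 := two_mul_deriv_of_sq_eq hxt hyt het
    rw [pullback, eta, zpow_zero, one_mul]
    field_simp
    linear_combination - (R.map (algebraMap ℝ ℂ)).eval (x t) * h2

/-- The homogenisation `δ ^ n p(ζ / δ)` of a polynomial of degree at most `n`. -/
def homogEval (p : ℂ[X]) (n : ℕ) (ζ δ : ℂ) : ℂ :=
  ∑ k ∈ Finset.range (n + 1), p.coeff k * ζ ^ k * δ ^ (n - k)

theorem homogEval_of_ne_zero {p : ℂ[X]} {n : ℕ} (hn : p.natDegree ≤ n) (ζ : ℂ) {δ : ℂ}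
    (hδ : δ ≠ 0) : homogEval p n ζ δ = δ ^ n * p.eval (ζ / δ) := by
  rw [homogEval, eval_eq_sum_range' (Nat.lt_succ_of_le hn), Finset.mul_sum]
  refine Finset.sum_congr rfl fun k hk => ?_
  have hk' : k ≤ n := Nat.lt_succ_iff.1 (Finset.mem_range.1 hk)
  rw [div_pow, pow_sub₀ _ hδ hk']
  field_simp

theorem homogEval_zero (p : ℂ[X]) (n : ℕ) (ζ : ℂ) : homogEval p n ζ 0 = p.coeff n * ζ ^ n := by
  rw [homogEval, Finset.sum_range_succ, Finset.sum_eq_zero, zero_add]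
  · simp
  · intro k hk
    have := Finset.mem_range.1 hk
    rw [zero_pow (by omega), mul_zero]

theorem IsParamInfty.pullback_eta {ε : ℂ} (hε : ε ^ 2 = 1) {R : ℝ[X]} (hRm : R.Monic)
    (hRd : R.natDegree = g) {x y : ℂ → ℂ} (hp : IsParamInfty a b ε x y) :
    ∃ h : ℂ → ℂ, AnalyticAt ℂ h 0 ∧ h 0 = -ε ∧
      ∀ᶠ t in 𝓝[≠] (0 : ℂ), pullback (eta R) x y t = t⁻¹ * h t := by
  obtain ⟨u, w, hu, hw, hu0, hw0, hd, hev⟩ := hp.exists_data hε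
  have hε0 : ε ≠ 0 := by rintro rfl; simp at hε
  obtain ⟨v, hv, hv0, hve⟩ := exists_eq_mul_of_deriv_ne_zero hu hu0 hd
  set S := R.map (algebraMap ℝ ℂ) with hS
  have hSm : S.Monic := hRm.map _
  have hSd : S.natDegree = g := by rw [hS, hRm.natDegree_map, hRd]
  refine ⟨fun t => -(homogEval S g 1 (u t) * deriv u t) / (w t * v t), ?_, ?_, ?_⟩
  · refine AnalyticAt.div ?_ (hw.mul hv) (by rw [hw0, hv0]; exact mul_ne_zero hε0 hd)
    refine (AnalyticAt.mul ?_ hu.deriv).neg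
    unfold homogEval
    fun_prop
  · have h1 : S.coeff g = 1 := by rw [← hSd]; exact hSm
    simp only [hu0, homogEval_zero, h1, hw0, hv0]
    field_simp
    simp [hε]
  · filter_upwards [hev, hve.filter_mono nhdsWithin_le_nhds, self_mem_nhdsWithin]
      with t ⟨hut, hwt, hut0, hwt0, hx, hy, _⟩ hvt ht0
    have ht0' : t ≠ 0 := ht0
    have hvt0 : v t ≠ 0 := by rintro h0; exact hut0 (by rw [hvt, h0, mul_zero])
    have hdx : deriv x t = -deriv u t / u t ^ 2 := by
      rw [Filter.EventuallyEq.deriv_eq hx]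
      simpa using (hut.hasDerivAt.fun_inv hut0).deriv
    rw [pullback, eta, hdx, hx.self_of_nhds, hy.self_of_nhds,
      homogEval_of_ne_zero hSd.le 1 hut0, ← hS]
    rw [show t⁻¹ = v t / u t by rw [hvt]; field_simp]
    field_simp
    ring

theorem hasOrderAt_infty {ε : ℂ} (hε : ε ^ 2 = 1) {R : ℝ[X]} (hRm : R.Monic)
    (hRd : R.natDegree = g) {x y : ℂ → ℂ} (hp : IsParamInfty a b ε x y) :
    MeromorphicAt (pullback (eta R) x y) 0 ∧
      meromorphicOrderAt (pullback (eta R) x y) 0 = ((-1 : ℤ) : WithTop ℤ) := by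
  obtain ⟨h, hh, h0, he⟩ := hp.pullback_eta hε hRm hRd
  have hε0 : ε ≠ 0 := by rintro rfl; simp at hε
  exact meromorphicOrderAt_eq_of_eventuallyEq hh (by rw [h0]; exact neg_ne_zero.2 hε0)
    (by simpa using he)

theorem hasResidueAt_infty {ε : ℂ} (hε : ε ^ 2 = 1) {R : ℝ[X]} (hRm : R.Monic)
    (hRd : R.natDegree = g) {x y : ℂ → ℂ} (hp : IsParamInfty a b ε x y) :
    ∀ᶠ s : ℝ in 𝓝[>] 0,
      (∮ t in C(0, s), pullback (eta R) x y t) = 2 * (Real.pi : ℂ) * Complex.I * (-ε) := by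
  obtain ⟨h, hh, h0, he⟩ := hp.pullback_eta hε hRm hRd
  obtain ⟨ρ, hρ, hball⟩ := Metric.eventually_nhds_iff_ball.1
    (hh.eventually_analyticAt.and (eventually_nhdsWithin_iff.1 he))
  filter_upwards [Ioo_mem_nhdsGT hρ] with s hs
  have hsub : Metric.closedBall (0 : ℂ) s ⊆ Metric.ball 0 ρ := Metric.closedBall_subset_ball hs.2
  rw [circleIntegral.integral_congr (g := fun t => (t - 0)⁻¹ • h t) hs.1.le,
    Complex.circleIntegral_sub_center_inv_smul_of_differentiable_on_off_countable hs.1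
      Set.countable_empty, h0, smul_eq_mul]
  · exact fun t ht => (hball t (hsub ht)).1.continuousAt.continuousWithinAt
  · exact fun t ht => (hball t (hsub (Metric.ball_subset_closedBall ht.1))).1.differentiableAt
  · intro t ht
    have ht0 : t ≠ 0 := by
      rintro rfl
      simp at ht
      exact hs.1.ne ht
    simpa using (hball t (hsub (Metric.sphere_subset_closedBall ht))).2 ht0

/-! ### Periods of the differentials `A dx / y` -/

theorem csqrt_eq_add (t : ℝ) : csqrt t = (√t : ℂ) + Complex.I * (√(-t) : ℂ) := by
  unfold csqrt
  split_ifs with h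
  · simp [Real.sqrt_eq_zero_of_nonpos (neg_nonpos.2 h)]
  · simp [Real.sqrt_eq_zero_of_nonpos (not_le.1 h).le]

theorem continuous_csqrt : Continuous csqrt := by
  rw [funext csqrt_eq_add]
  fun_prop

theorem csqrt_sq (t : ℝ) : csqrt t ^ 2 = t := by
  unfold csqrt
  split_ifs with h
  · exact_mod_cast Real.sq_sqrt h
  · rw [mul_pow, Complex.I_sq, ← Complex.ofReal_pow, Real.sq_sqrt (by linarith)]
    simp

theorem csqrt_of_nonneg {t : ℝ} (h : 0 ≤ t) : csqrt t = (√|t| : ℂ) := by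
  rw [csqrt, if_pos h, abs_of_nonneg h]

theorem csqrt_of_nonpos {t : ℝ} (h : t ≤ 0) : csqrt t = Complex.I * (√|t| : ℂ) := by
  rcases h.eq_or_lt with rfl | h
  · simp [csqrt]
  · rw [csqrt, if_neg (not_le.2 h), abs_of_neg h]

/-- `e < e'` are consecutive branch points. -/
structure Consecutive (a b : Fin (g + 1) → ℝ) (e e' : ℝ) : Prop where
  lt : e < e'
  left : (polyD a b).eval e = 0
  right : (polyD a b).eval e' = 0
  ne_zero : ∀ x ∈ Set.Ioo e e', (polyD a b).eval x ≠ 0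

theorem Ordered.consecutive_band (h : Ordered a b) (j : Fin (g + 1)) :
    Consecutive a b (a j) (b j) :=
  ⟨h.1 j, eval_polyD_a a b j, eval_polyD_b a b j, fun _ hx => (h.eval_polyD_neg hx).ne⟩

theorem Ordered.consecutive_gap (h : Ordered a b) (j : Fin g) :
    Consecutive a b (b j.castSucc) (a j.succ) :=
  ⟨h.2 j, eval_polyD_b a b _, eval_polyD_a a b _, fun _ hx => (h.eval_polyD_pos hx).ne'⟩

theorem Ordered.eval_polyD_nonpos (h : Ordered a b) {j : Fin (g + 1)} {x : ℝ}
    (hx : x ∈ Set.uIcc (a j) (b j)) : (polyD a b).eval x ≤ 0 := by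
  rw [Set.uIcc_of_le (h.1 j).le] at hx
  rcases hx.1.eq_or_lt with rfl | h1
  · exact (eval_polyD_a a b j).le
  rcases hx.2.eq_or_lt with rfl | h2
  · exact (eval_polyD_b a b j).le
  exact (h.eval_polyD_neg ⟨h1, h2⟩).le

theorem Ordered.eval_polyD_nonneg (h : Ordered a b) {j : Fin g} {x : ℝ}
    (hx : x ∈ Set.uIcc (b j.castSucc) (a j.succ)) : 0 ≤ (polyD a b).eval x := by
  rw [Set.uIcc_of_le (h.2 j).le] at hx
  rcases hx.1.eq_or_lt with rfl | h1
  · exact (eval_polyD_b a b _).ge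
  rcases hx.2.eq_or_lt with rfl | h2
  · exact (eval_polyD_a a b _).ge
  exact (h.eval_polyD_pos ⟨h1, h2⟩).le

theorem intervalIntegrable_inv_sqrt_mul {e e' : ℝ} (h : e < e') :
    IntervalIntegrable (fun x => (√((x - e) * (e' - x)))⁻¹) MeasureTheory.volume e e' := by
  rw [intervalIntegrable_iff, Set.uIoc_of_le h.le]
  have hl : 0 < e' - e := sub_pos.2 h
  refine intervalIntegral.integrableOn_deriv_of_nonneg
    (g := fun x => Real.arcsin ((2 * x - e - e') / (e' - e)))
    (Continuous.continuousOn (by fun_prop)) (fun x hx => ?_) (fun x _ => by positivity)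
  have hx1 : 0 < x - e := sub_pos.2 hx.1
  have hx2 : 0 < e' - x := sub_pos.2 hx.2
  have h1 : (2 * x - e - e') / (e' - e) ≠ -1 := by
    rw [Ne, div_eq_iff hl.ne']; intro h; linarith
  have h2 : (2 * x - e - e') / (e' - e) ≠ 1 := by
    rw [Ne, div_eq_iff hl.ne']; intro h; linarith
  have hd : HasDerivAt (fun x : ℝ => (2 * x - e - e') / (e' - e)) (2 / (e' - e)) x := by
    simpa using ((((hasDerivAt_id x).const_mul 2).sub_const e).sub_const e').div_const (e' - e)
  have hs : √(1 - ((2 * x - e - e') / (e' - e)) ^ 2) = 2 / (e' - e) * √((x - e) * (e' - x)) := by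
    rw [← Real.sqrt_sq (show 0 ≤ 2 / (e' - e) by positivity), ← Real.sqrt_mul (sq_nonneg _)]
    congr 1
    field_simp
    ring
  have hv : (√((x - e) * (e' - x)))⁻¹ =
      1 / √(1 - ((2 * x - e - e') / (e' - e)) ^ 2) * (2 / (e' - e)) := by
    rw [hs]
    have := (Real.sqrt_pos.2 (mul_pos hx1 hx2)).ne'
    field_simp
  rw [hv]
  exact (Real.hasDerivAt_arcsin h1 h2).comp x hd

/-- Convergence of `∫ A / √|D|` between consecutive branch points: `D` has simple zeros, so the
integrand is `O(1 / √((x - e) (e' - x)))`. -/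
theorem Consecutive.intervalIntegrable (hab : Ordered a b) {e e' : ℝ} (h : Consecutive a b e e')
    (A : ℝ[X]) :
    IntervalIntegrable (fun x => A.eval x / √|(polyD a b).eval x|) MeasureTheory.volume e e' := by
  obtain ⟨E₁, hE₁⟩ := dvd_iff_isRoot.2 h.left
  have h1 : E₁.eval e' = 0 := by
    have := h.right
    rw [hE₁] at this
    simpa [sub_ne_zero.2 h.lt.ne'] using this
  obtain ⟨E, hE⟩ := dvd_iff_isRoot.2 h1
  have hD : ∀ x, (polyD a b).eval x = (x - e) * ((x - e') * E.eval x) := fun x => by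
    rw [hE₁, hE]; simp
  have hsep : ∀ x, (polyD a b).eval x = 0 → (polyD a b).derivative.eval x ≠ 0 := fun x hx =>
    Separable.eval₂_derivative_ne_zero (RingHom.id ℝ) hab.separable_polyD hx
  have hE0 : ∀ x ∈ Set.uIcc e e', E.eval x ≠ 0 := by
    intro x hx h0
    rw [Set.uIcc_of_le h.lt.le] at hx
    have hx0 : (polyD a b).eval x = 0 := by rw [hD, h0]; ring
    have hend : x = e ∨ x = e' := by
      by_contra! hne
      exact h.ne_zero x ⟨lt_of_le_of_ne hx.1 hne.1.symm, lt_of_le_of_ne hx.2 hne.2⟩ hx0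
    refine hsep x hx0 ?_
    rw [hE₁, hE]
    rcases hend with rfl | rfl <;> simp [h0]
  have hcont : ContinuousOn (fun x => A.eval x / √|E.eval x|) (Set.uIcc e e') := by
    refine ContinuousOn.div (by fun_prop) (by fun_prop) fun x hx => ?_
    exact (Real.sqrt_pos.2 (abs_pos.2 (hE0 x hx))).ne'
  refine ((intervalIntegrable_inv_sqrt_mul h.lt).continuousOn_mul hcont).congr fun x hx => ?_
  rw [Set.uIoc_of_le h.lt.le] at hx
  have h3 : |(polyD a b).eval x| = |E.eval x| * ((x - e) * (e' - x)) := by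
    rw [hD, abs_mul, abs_mul, abs_of_nonneg (sub_nonneg.2 hx.1.le),
      abs_of_nonpos (sub_nonpos.2 hx.2)]
    ring
  simp only [h3, Real.sqrt_mul (abs_nonneg _)]
  rw [div_mul_eq_div_div, div_eq_mul_inv (A.eval x / _)]

theorem Consecutive.integral_pos (hab : Ordered a b) {e e' : ℝ} (h : Consecutive a b e e')
    {A : ℝ[X]} (hA : ∀ x ∈ Set.Ioo e e', 0 < A.eval x) :
    0 < ∫ x in e..e', A.eval x / √|(polyD a b).eval x| :=
  intervalIntegral.intervalIntegral_pos_of_pos_on (h.intervalIntegrable hab A)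
    (fun x hx => div_pos (hA x hx) (Real.sqrt_pos.2 (abs_pos.2 (h.ne_zero x hx)))) h.lt

theorem Consecutive.exists_root (hab : Ordered a b) {e e' : ℝ} (h : Consecutive a b e e')
    {A : ℝ[X]} (hA : ∫ x in e..e', A.eval x / √|(polyD a b).eval x| = 0) :
    ∃ x ∈ Set.Ioo e e', A.eval x = 0 := by
  by_contra! hne
  have hsign : (∀ x ∈ Set.Ioo e e', 0 < A.eval x) ∨ ∀ x ∈ Set.Ioo e e', A.eval x < 0 := by
    by_contra! hcon
    obtain ⟨⟨x, hx, hx0⟩, y, hy, hy0⟩ := hcon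
    obtain ⟨z, hz, hz0⟩ := isPreconnected_Ioo.intermediate_value hx hy A.continuousOn ⟨hx0, hy0⟩
    exact hne z hz hz0
  rcases hsign with hs | hs
  · exact (h.integral_pos hab hs).ne' hA
  · refine (h.integral_pos hab (A := -A) fun x hx => by simpa using hs x hx).ne' ?_
    simp only [eval_neg, neg_div]
    rw [intervalIntegral.integral_neg, hA, neg_zero]

theorem integrand_of_nonneg {x : ℝ} (h : 0 ≤ (polyD a b).eval x) (A : ℝ[X]) :
    integrand a b A x = ((A.eval x / √|(polyD a b).eval x| : ℝ) : ℂ) := by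
  rw [integrand, csqrt_of_nonneg h]
  push_cast
  rfl

theorem integrand_of_nonpos {x : ℝ} (h : (polyD a b).eval x ≤ 0) (A : ℝ[X]) :
    integrand a b A x = -Complex.I * ((A.eval x / √|(polyD a b).eval x| : ℝ) : ℂ) := by
  rw [integrand, csqrt_of_nonpos h, div_mul_eq_div_div, div_right_comm, Complex.div_I]
  push_cast
  ring

theorem Ordered.intervalIntegrable_gap (hab : Ordered a b) (A : ℝ[X]) (j : Fin g) :
    IntervalIntegrable (integrand a b A) MeasureTheory.volume (b j.castSucc) (a j.succ) := by
  have h := (hab.consecutive_gap j).intervalIntegrable hab A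
  have h' : IntervalIntegrable
      (fun x => ((A.eval x / √|(polyD a b).eval x| : ℝ) : ℂ)) MeasureTheory.volume
      (b j.castSucc) (a j.succ) := ⟨h.1.ofReal, h.2.ofReal⟩
  exact h'.congr fun x hx =>
    (integrand_of_nonneg (hab.eval_polyD_nonneg (Set.uIoc_subset_uIcc hx)) A).symm

theorem Ordered.intervalIntegrable_band (hab : Ordered a b) (A : ℝ[X]) (j : Fin (g + 1)) :
    IntervalIntegrable (integrand a b A) MeasureTheory.volume (a j) (b j) := by
  have h := (hab.consecutive_band j).intervalIntegrable hab A
  have h' : IntervalIntegrable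
      (fun x => ((A.eval x / √|(polyD a b).eval x| : ℝ) : ℂ)) MeasureTheory.volume
      (a j) (b j) := ⟨h.1.ofReal, h.2.ofReal⟩
  exact (h'.const_mul (-Complex.I)).congr fun x hx =>
    (integrand_of_nonpos (hab.eval_polyD_nonpos (Set.uIoc_subset_uIcc hx)) A).symm

theorem Ordered.realPeriod_eq (hab : Ordered a b) (A : ℝ[X]) (j : Fin g) :
    realPeriod a b A j =
      ((∫ x in (b j.castSucc)..(a j.succ), A.eval x / √|(polyD a b).eval x| : ℝ) : ℂ) := by
  rw [realPeriod, ← intervalIntegral.integral_ofReal]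
  exact intervalIntegral.integral_congr fun x hx => integrand_of_nonneg (hab.eval_polyD_nonneg hx) A

theorem Ordered.imagHalfPeriod_eq (hab : Ordered a b) (A : ℝ[X]) (j : Fin (g + 1)) :
    imagHalfPeriod a b A j =
      -Complex.I * ((∫ x in (a j)..(b j), A.eval x / √|(polyD a b).eval x| : ℝ) : ℂ) := by
  rw [imagHalfPeriod, ← intervalIntegral.integral_ofReal, ← intervalIntegral.integral_const_mul]
  exact intervalIntegral.integral_congr fun x hx => integrand_of_nonpos (hab.eval_polyD_nonpos hx) A

/-- Numbers chosen in distinct gaps are distinct. -/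
theorem Ordered.strictMono_of_mem_gap (hab : Ordered a b) {ρ : Fin g → ℝ}
    (hρ : ∀ j, ρ j ∈ Set.Ioo (b j.castSucc) (a j.succ)) : StrictMono ρ := by
  intro i j hij
  have h1 : i.succ ≤ j.castSucc := hij
  have h2 := hab.strictMono_a.monotone h1
  have h3 := hab.1 j.castSucc
  linarith [(hρ i).2, (hρ j).1]

theorem Ordered.exists_roots (hab : Ordered a b) {A : ℝ[X]} (hA : ∀ j, realPeriod a b A j = 0) :
    ∃ ρ : Fin g → ℝ, (∀ j, ρ j ∈ Set.Ioo (b j.castSucc) (a j.succ)) ∧ ∀ j, A.eval (ρ j) = 0 := by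
  have (j : Fin g) := (hab.consecutive_gap j).exists_root hab (A := A)
    (by have := hA j; rw [hab.realPeriod_eq] at this; exact_mod_cast this)
  choose ρ h1 h2 using this
  exact ⟨ρ, h1, h2⟩

theorem eq_of_eval_eq_of_natDegree_eq {A B : ℝ[X]} (hA : A.Monic)
    (hB : B.Monic) (hAd : A.natDegree = g) (hBd : B.natDegree = g) {ρ : Fin g → ℝ}
    (hρ : Function.Injective ρ) (hAB : ∀ j, A.eval (ρ j) = B.eval (ρ j)) : A = B := by
  by_contra hne
  have hdeg : (A - B).natDegree < g := by
    have := degree_sub_lt_left (by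
      rw [degree_eq_natDegree hA.ne_zero, degree_eq_natDegree hB.ne_zero, hAd, hBd]) hA.ne_zero (hA.leadingCoeff.trans hB.leadingCoeff.symm)
    rw [← hAd]
    exact natDegree_lt_natDegree (sub_ne_zero.2 hne) this
  exact sub_ne_zero.2 hne <| eq_zero_of_natDegree_lt_card_of_eval_eq_zero _ hρ
    (fun j => by simp [hAB]) (by simpa using hdeg)

theorem IsCanonical.unique (hab : Ordered a b) {R R' : ℝ[X]} (h : IsCanonical a b R)
    (h' : IsCanonical a b R') : R' = R := by
  obtain ⟨hm, hd, hp⟩ := h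
  obtain ⟨hm', hd', hp'⟩ := h'
  have hsub : ∀ j, realPeriod a b (R' - R) j = 0 := by
    intro j
    have h1 : realPeriod a b (R' - R) j = realPeriod a b R' j - realPeriod a b R j := by
      rw [realPeriod, realPeriod, realPeriod, ← intervalIntegral.integral_sub
        (hab.intervalIntegrable_gap R' j) (hab.intervalIntegrable_gap R j)]
      refine intervalIntegral.integral_congr fun x _ => ?_
      simp [integrand, sub_div]
    rw [h1, hp, hp', sub_zero]
  obtain ⟨ρ, hρ, hρ0⟩ := hab.exists_roots hsub
  exact eq_of_eval_eq_of_natDegree_eq hm' hm hd' hd (hab.strictMono_of_mem_gap hρ).injective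
    fun j => by simpa [sub_eq_zero] using hρ0 j

/-- The zeros of the canonical polynomial: one in each gap. -/
theorem IsCanonical.exists_eq_prod (hab : Ordered a b) {R : ℝ[X]} (h : IsCanonical a b R) :
    ∃ ρ : Fin g → ℝ, (∀ j, ρ j ∈ Set.Ioo (b j.castSucc) (a j.succ)) ∧ R = ∏ j, (X - C (ρ j)) := by
  obtain ⟨hm, hd, hp⟩ := h
  obtain ⟨ρ, hρ, hρ0⟩ := hab.exists_roots hp
  refine ⟨ρ, hρ, eq_of_eval_eq_of_natDegree_eq hm (monic_prod_of_monic _ _ fun _ _ =>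
    monic_X_sub_C _) hd ?_ (hab.strictMono_of_mem_gap hρ).injective fun j => ?_⟩
  · rw [natDegree_prod_of_monic _ _ fun _ _ => monic_X_sub_C _]
    simp
  · rw [hρ0, eval_prod]
    exact (Finset.prod_eq_zero (Finset.mem_univ j) (by simp)).symm

/-! ### Continuous logarithms -/

theorem exists_continuous_log {X : Type*} [TopologicalSpace X] [SimplyConnectedSpace X]
    [LocallyPathConnectedSpace X] {F : X → ℂ} (hF : Continuous F) (h0 : ∀ x, F x ≠ 0) :
    ∃ L : X → ℂ, Continuous L ∧ ∀ x, Complex.exp (L x) = F x := by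
  have hne : Nonempty X := PathConnectedSpace.nonempty
  obtain ⟨x₀⟩ := hne
  obtain ⟨L, ⟨-, hL⟩, -⟩ := Complex.isCoveringMapOn_exp.existsUnique_continuousMap_lifts ⟨F, hF⟩
    (a₀ := x₀) (e₀ := Complex.log (F x₀)) (Complex.exp_log (h0 x₀)) h0
  exact ⟨L, L.continuous, fun x => congrFun hL x⟩

theorem eq_of_exp_eq_const {X : Type*} [TopologicalSpace X] {s : Set X} (hs : IsPreconnected s)
    {h : X → ℂ} (hc : ContinuousOn h s) {k : ℂ} (hk : ∀ x ∈ s, Complex.exp (h x) = k) {x y : X}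
    (hx : x ∈ s) (hy : y ∈ s) : h x = h y :=
  Complex.isCoveringMap_exp.constOn_of_comp hs hc
    (fun u hu v hv => Subtype.ext ((hk u hu).trans (hk v hv).symm)) hx hy

/-- A continuous branch of the inverse of `φ` along a differentiable function is differentiable. -/
theorem hasDerivAt_of_comp_eq {φ : ℂ → ℂ} {φ' : ℂ} {L q : ℝ → ℂ} {q' : ℂ} {x : ℝ}
    (hφ : HasStrictDerivAt φ φ' (L x)) (hφ' : φ' ≠ 0) (hL : ContinuousAt L x)
    (hq : HasDerivAt q q' x) (h : ∀ t, φ (L t) = q t) : HasDerivAt L (q' / φ') x := by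
  have h1 : HasDerivAt (hφ.localInverse φ φ' (L x) hφ') φ'⁻¹ (q x) := by
    rw [← h]; exact (hφ.to_localInverse hφ').hasDerivAt
  have h2 := h1.scomp x hq
  rw [smul_eq_mul, ← div_eq_mul_inv] at h2
  refine h2.congr_of_eventuallyEq ?_
  filter_upwards [hL.eventually (hφ.eventually_left_inverse hφ')] with t ht
  rw [Function.comp_apply, ← h, ht]

/-! ### The square root of `D` on the closed upper half-plane -/

/-- The retraction `x + i y ↦ x + i |y|` of the plane onto the closed upper half-plane. -/
def foldUp (z : ℂ) : ℂ := ⟨z.re, |z.im|⟩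

/-- The square root of `foldUp z` in the closed first quadrant. It is a continuous function on the
whole plane, and extends the principal square root of the upper half-plane. -/
noncomputable def foldSqrt (z : ℂ) : ℂ := ⟨√((‖z‖ + z.re) / 2), √((‖z‖ - z.re) / 2)⟩

theorem continuous_foldUp : Continuous foldUp :=
  Complex.equivRealProdCLM.symm.continuous.comp
    (Complex.continuous_re.prodMk Complex.continuous_im.abs)

theorem continuous_foldSqrt : Continuous foldSqrt :=
  Complex.equivRealProdCLM.symm.continuous.comp
    (Continuous.prodMk (by fun_prop) (by fun_prop))

theorem foldUp_of_nonneg {z : ℂ} (h : 0 ≤ z.im) : foldUp z = z :=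
  Complex.ext rfl (abs_of_nonneg h)

theorem foldUp_ofReal (x : ℝ) : foldUp x = x := foldUp_of_nonneg (by simp)

theorem foldUp_sub_ofReal (z : ℂ) (x : ℝ) : foldUp (z - x) = foldUp z - x := by
  apply Complex.ext <;> simp [foldUp]

theorem foldUp_div_ofReal (z : ℂ) {δ : ℝ} (hδ : 0 < δ) : foldUp (z / δ) = foldUp z / δ := by
  apply Complex.ext <;> simp [foldUp, Complex.div_ofReal_re, Complex.div_ofReal_im, abs_div,
    abs_of_pos hδ]

theorem foldUp_ne_zero {z : ℂ} (hz : z ≠ 0) : foldUp z ≠ 0 := by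
  intro h
  apply hz
  have h1 : z.re = 0 := congrArg Complex.re h
  have h2 : |z.im| = 0 := congrArg Complex.im h
  exact Complex.ext h1 (abs_eq_zero.1 h2)

theorem foldSqrt_sq (z : ℂ) : foldSqrt z ^ 2 = foldUp z := by
  have h1 : 0 ≤ (‖z‖ + z.re) / 2 := by linarith [neg_abs_le z.re, Complex.abs_re_le_norm z]
  have h2 : 0 ≤ (‖z‖ - z.re) / 2 := by linarith [le_abs_self z.re, Complex.abs_re_le_norm z]
  apply Complex.ext
  · rw [sq, Complex.mul_re]
    simp only [foldSqrt, foldUp, Real.mul_self_sqrt h1, Real.mul_self_sqrt h2]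
    ring
  · rw [sq, Complex.mul_im]
    simp only [foldSqrt, foldUp]
    have h3 : √((‖z‖ + z.re) / 2) * √((‖z‖ - z.re) / 2) = |z.im| / 2 := by
      rw [← Real.sqrt_mul h1, ← Real.sqrt_sq (show 0 ≤ |z.im| / 2 by positivity)]
      congr 1
      have := Complex.sq_norm z
      rw [Complex.normSq_apply] at this
      rw [div_pow, sq_abs]
      linear_combination this / 4
    linear_combination 2 * h3

theorem foldSqrt_ofReal (x : ℝ) : foldSqrt x = csqrt x := by
  rw [csqrt_eq_add]
  rcases le_total 0 x with h | h
  · rw [Real.sqrt_eq_zero_of_nonpos (neg_nonpos.2 h)]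
    apply Complex.ext <;> simp [foldSqrt, abs_of_nonneg h]
  · have h1 : (-x - x) / 2 = -x := by ring
    rw [Real.sqrt_eq_zero_of_nonpos h]
    apply Complex.ext <;> simp [foldSqrt, abs_of_nonpos h, h1]

theorem foldSqrt_ofReal_mul {δ : ℝ} (hδ : 0 ≤ δ) (z : ℂ) :
    foldSqrt (δ * z) = (√δ : ℂ) * foldSqrt z := by
  have h1 : (δ * ‖z‖ + δ * z.re) / 2 = δ * ((‖z‖ + z.re) / 2) := by ring
  have h2 : (δ * ‖z‖ - δ * z.re) / 2 = δ * ((‖z‖ - z.re) / 2) := by ring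
  apply Complex.ext <;>
    simp [foldSqrt, abs_of_nonneg hδ, h1, h2, Real.sqrt_mul hδ]

/-- The branch of `√D` on the closed upper half-plane that is positive on the real half-line to
the right of all branch points, composed with `foldUp`. -/
noncomputable def sqrtD (a b : Fin (g + 1) → ℝ) (z : ℂ) : ℂ :=
  ∏ i, foldSqrt (z - a i) * foldSqrt (z - b i)

theorem continuous_sqrtD (a b : Fin (g + 1) → ℝ) : Continuous (sqrtD a b) :=
  continuous_finsetProd _ fun _ _ =>
    (continuous_foldSqrt.comp (by fun_prop)).mul (continuous_foldSqrt.comp (by fun_prop))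

theorem sqrtD_sq (a b : Fin (g + 1) → ℝ) (z : ℂ) :
    sqrtD a b z ^ 2 = (polyDC a b).eval (foldUp z) := by
  simp only [sqrtD, ← Finset.prod_pow, mul_pow, foldSqrt_sq, foldUp_sub_ofReal, eval_polyDC]

theorem sqrtD_ofReal_sq (a b : Fin (g + 1) → ℝ) (x : ℝ) :
    sqrtD a b x ^ 2 = (((polyD a b).eval x : ℝ) : ℂ) := by
  rw [sqrtD_sq, foldUp_ofReal, eval_polyDC_ofReal]

theorem sqrtD_ofReal_im {x : ℝ} (h : 0 < (polyD a b).eval x) : (sqrtD a b x).im = 0 := by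
  have h1 := sqrtD_ofReal_sq a b x
  have hre := congrArg Complex.re h1
  have him := congrArg Complex.im h1
  rw [sq, Complex.mul_re, Complex.ofReal_re] at hre
  rw [sq, Complex.mul_im, Complex.ofReal_im] at him
  by_contra h0
  have h2 : (sqrtD a b x).re = 0 := by
    have : (sqrtD a b x).re * (sqrtD a b x).im = 0 := by linarith
    exact (mul_eq_zero.1 this).resolve_right h0
  rw [h2] at hre
  nlinarith [mul_self_nonneg (sqrtD a b x).im]

theorem hasDerivAt_sqrtD {x : ℝ} (h : (polyD a b).eval x ≠ 0) :
    HasDerivAt (fun t : ℝ => sqrtD a b t)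
      ((polyDC a b).derivative.eval (x : ℂ) / (2 * sqrtD a b x)) x := by
  have h0 : sqrtD a b x ≠ 0 := by
    intro h1
    have h2 := sqrtD_ofReal_sq a b x
    rw [h1] at h2
    exact h (by simpa using h2.symm)
  have hφ : HasStrictDerivAt (fun z : ℂ => z ^ 2) (2 * sqrtD a b x) (sqrtD a b x) := by
    simpa using hasStrictDerivAt_pow 2 (sqrtD a b x)
  exact hasDerivAt_of_comp_eq (L := fun t : ℝ => sqrtD a b t) hφ (mul_ne_zero two_ne_zero h0)
    ((continuous_sqrtD a b).comp Complex.continuous_ofReal).continuousAt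
    ((polyDC a b).hasDerivAt (x : ℂ)).comp_ofReal
    fun t => by rw [sqrtD_sq, foldUp_ofReal]

theorem Consecutive.exists_sign {e e' : ℝ} (h : Consecutive a b e e') :
    ∃ η : ℝ, (η = 1 ∨ η = -1) ∧
      ∀ x ∈ Set.Ioo e e', sqrtD a b x = η * csqrt ((polyD a b).eval x) := by
  have := isPreconnected_Ioo.eq_or_eq_neg_of_sq_eq (S := Set.Ioo e e')
    (f := fun x : ℝ => sqrtD a b x) (g := fun x : ℝ => csqrt ((polyD a b).eval x))
    ((continuous_sqrtD a b).comp Complex.continuous_ofReal).continuousOn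
    (continuous_csqrt.comp (polyD a b).continuous).continuousOn
    (fun x _ => by simp only [Pi.pow_apply, sqrtD_ofReal_sq, csqrt_sq])
    (fun {x} hx h0 => h.ne_zero x hx (by
      have := csqrt_sq ((polyD a b).eval x)
      rw [h0] at this
      simpa using this.symm))
  rcases this with h | h
  · exact ⟨1, Or.inl rfl, fun x hx => by simpa using h hx⟩
  · exact ⟨-1, Or.inr rfl, fun x hx => by simpa using h hx⟩

theorem exists_csqrt_mul_eq_of_mem {a b x : ℝ} (ha : a < x) (hb : x < b) :
    ∃ m : ℝ, 0 < m ∧ csqrt (x - a) * csqrt (x - b) = Complex.I * m := by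
  refine ⟨√|x - a| * √|x - b|, mul_pos (Real.sqrt_pos.2 (abs_pos.2 (sub_pos.2 ha).ne'))
    (Real.sqrt_pos.2 (abs_pos.2 (sub_neg.2 hb).ne)), ?_⟩
  rw [csqrt_of_nonneg (sub_pos.2 ha).le, csqrt_of_nonpos (sub_neg.2 hb).le]
  push_cast
  ring

theorem exists_csqrt_mul_eq {a b x ρ : ℝ}
    (h : (a < x ∧ b < x ∧ ρ < x) ∨ (x < a ∧ x < b ∧ x < ρ)) :
    ∃ m : ℝ, 0 < m ∧ csqrt (x - a) * csqrt (x - b) = m * (x - ρ) := by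
  rcases h with ⟨ha, hb, hρ⟩ | ⟨ha, hb, hρ⟩
  · have h1 : 0 < x - ρ := sub_pos.2 hρ
    refine ⟨√|x - a| * √|x - b| / (x - ρ), div_pos
      (mul_pos (Real.sqrt_pos.2 (abs_pos.2 (sub_pos.2 ha).ne'))
        (Real.sqrt_pos.2 (abs_pos.2 (sub_pos.2 hb).ne'))) h1, ?_⟩
    rw [csqrt_of_nonneg (sub_pos.2 ha).le, csqrt_of_nonneg (sub_pos.2 hb).le, ← Complex.ofReal_sub,
      ← Complex.ofReal_mul, ← Complex.ofReal_mul, div_mul_cancel₀ _ h1.ne']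
  · have h1 : x - ρ < 0 := sub_neg.2 hρ
    refine ⟨-(√|x - a| * √|x - b|) / (x - ρ), div_pos_of_neg_of_neg (neg_neg_of_pos
      (mul_pos (Real.sqrt_pos.2 (abs_pos.2 (sub_neg.2 ha).ne))
        (Real.sqrt_pos.2 (abs_pos.2 (sub_neg.2 hb).ne)))) h1, ?_⟩
    rw [csqrt_of_nonpos (sub_neg.2 ha).le, csqrt_of_nonpos (sub_neg.2 hb).le, ← Complex.ofReal_sub,
      ← Complex.ofReal_mul, div_mul_cancel₀ _ h1.ne]
    push_cast
    linear_combination ((√|x - a| : ℂ) * √|x - b|) * Complex.I_sq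

/-- On every band, `√D / R` is a positive multiple of `i`: both `√D` and `R` change their sign (by
a factor `-1`) from one band to the next. -/
theorem Ordered.exists_sqrtD_eq (hab : Ordered a b) {ρ : Fin g → ℝ}
    (hρ : ∀ j, ρ j ∈ Set.Ioo (b j.castSucc) (a j.succ)) {j : Fin (g + 1)} {x : ℝ}
    (hx : x ∈ Set.Ioo (a j) (b j)) :
    ∃ m : ℝ, 0 < m ∧
      sqrtD a b x = Complex.I * (m * ((∏ k, (X - C (ρ k)) : ℝ[X]).eval x : ℝ) : ℝ) := by
  obtain ⟨m₀, hm₀, h₀⟩ := exists_csqrt_mul_eq_of_mem hx.1 hx.2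
  have hk : ∀ k : Fin g, ∃ m : ℝ, 0 < m ∧
      csqrt (x - a (j.succAbove k)) * csqrt (x - b (j.succAbove k)) = m * (x - ρ k) := by
    intro k
    apply exists_csqrt_mul_eq
    rcases lt_or_ge k.castSucc j with hkj | hkj
    · rw [Fin.succAbove_of_castSucc_lt _ _ hkj]
      have h1 := hab.b_lt_a hkj
      have h2 := hab.1 k.castSucc
      have h3 := hab.strictMono_a.monotone (Fin.castSucc_lt_iff_succ_le.1 hkj)
      exact Or.inl ⟨by linarith [hx.1], by linarith [hx.1], by linarith [hx.1, (hρ k).2]⟩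
    · rw [Fin.succAbove_of_le_castSucc _ _ hkj]
      have h1 := hab.strictMono_b.monotone hkj
      have h2 := hab.1 k.succ
      have h3 := hab.2 k
      exact Or.inr ⟨by linarith [hx.2], by linarith [hx.2], by linarith [hx.2, (hρ k).1]⟩
  choose m hm hmk using hk
  refine ⟨m₀ * ∏ k, m k, mul_pos hm₀ (Finset.prod_pos fun k _ => hm k), ?_⟩
  have h1 : sqrtD a b x = ∏ i, csqrt (x - a i) * csqrt (x - b i) := by
    simp only [sqrtD, ← foldSqrt_ofReal, Complex.ofReal_sub]
  rw [h1, Fin.prod_univ_succAbove _ j, h₀, Finset.prod_congr rfl fun k _ => hmk k,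
    Finset.prod_mul_distrib, eval_prod]
  simp only [eval_sub, eval_X, eval_C]
  push_cast
  ring

/-! ### The logarithm of a solution on the closed upper half-plane -/

/-- The solution `P + y Q` on the closed upper half-plane, with `y = √D`. -/
noncomputable def branch (a b : Fin (g + 1) → ℝ) (P Q : ℂ[X]) (z : ℂ) : ℂ :=
  P.eval (foldUp z) + sqrtD a b z * Q.eval (foldUp z)

theorem continuous_branch (a b : Fin (g + 1) → ℝ) (P Q : ℂ[X]) : Continuous (branch a b P Q) :=
  (P.continuous.comp continuous_foldUp).add
    ((continuous_sqrtD a b).mul (Q.continuous.comp continuous_foldUp))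

theorem branch_ofReal (P Q : ℂ[X]) (x : ℝ) :
    branch a b P Q x = P.eval (x : ℂ) + sqrtD a b x * Q.eval (x : ℂ) := by
  rw [branch, foldUp_ofReal]

theorem IsSolution.branch_ne_zero {c : ℂ} {P Q : ℂ[X]} (h : IsSolution a b c P Q) (z : ℂ) :
    branch a b P Q z ≠ 0 := by
  intro h0
  have h1 := congrArg (eval (foldUp z)) h.2.2.2
  simp only [eval_sub, eval_mul, eval_pow, eval_C, ← sqrtD_sq] at h1
  refine h.1 ?_
  rw [branch] at h0
  linear_combination (P.eval (foldUp z) - sqrtD a b z * Q.eval (foldUp z)) * h0 - h1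

/-- At the branch points `f ^ 2 = c`, so the logarithm of `f` changes by a multiple of `π i`. -/
theorem IsSolution.exists_log_sub_eq {c : ℂ} {P Q : ℂ[X]} (h : IsSolution a b c P Q) {L : ℂ → ℂ}
    (hL : ∀ z, Complex.exp (L z) = branch a b P Q z) {e e' : ℝ}
    (he : (polyD a b).eval e = 0) (he' : (polyD a b).eval e' = 0) :
    ∃ n : ℤ, L e' - L e = n * Real.pi * Complex.I := by
  have hsq : ∀ x : ℝ, (polyD a b).eval x = 0 → Complex.exp (L x) ^ 2 = c := by
    intro x hx
    have h1 := congrArg (eval (x : ℂ)) h.2.2.2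
    simp only [eval_sub, eval_mul, eval_pow, eval_C, eval_polyDC_ofReal, hx] at h1
    have h2 : sqrtD a b x = 0 := by simpa [hx] using sqrtD_ofReal_sq a b x
    rw [hL, branch_ofReal, h2, ← h1]
    simp
  have h3 : Complex.exp (2 * (L e' - L e)) = 1 := by
    rw [two_mul, Complex.exp_add, ← sq, Complex.exp_sub, div_pow, hsq e he, hsq e' he',
      div_self h.1]
  obtain ⟨n, hn⟩ := Complex.exp_eq_one_iff.1 h3
  exact ⟨n, by linear_combination hn / 2⟩

section Log

variable {c : ℂ} {P Q S : ℂ[X]} {L : ℂ → ℂ}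

theorem IsSolution.hasDerivAt_log (h : IsSolution a b c P Q)
    (hP : derivative P = C (P.natDegree : ℂ) * (Q * S))
    (hS : 2 * C (P.natDegree : ℂ) * (P * S) =
      derivative (polyDC a b) * Q + 2 * polyDC a b * derivative Q)
    (hLc : Continuous L) (hL : ∀ z, Complex.exp (L z) = branch a b P Q z) {x : ℝ}
    (hx : (polyD a b).eval x ≠ 0) :
    HasDerivAt (fun t : ℝ => L t) (P.natDegree * S.eval (x : ℂ) / sqrtD a b x) x := by
  have hσ := hasDerivAt_sqrtD hx
  have hσ2 := sqrtD_ofReal_sq a b x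
  have hσ0 : sqrtD a b x ≠ 0 := by
    intro h1
    rw [h1] at hσ2
    exact hx (by simpa using hσ2.symm)
  have hf := (P.hasDerivAt (x : ℂ)).comp_ofReal.add
    (hσ.mul (Q.hasDerivAt (x : ℂ)).comp_ofReal)
  have hb0 := h.branch_ne_zero (x : ℂ)
  have hφ : HasStrictDerivAt Complex.exp (branch a b P Q x) (L x) := by
    rw [← hL]; exact Complex.hasStrictDerivAt_exp _
  have := hasDerivAt_of_comp_eq (L := fun t : ℝ => L t) hφ hb0
    (hLc.comp Complex.continuous_ofReal).continuousAt hf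
    fun t => by rw [hL, branch_ofReal]; rfl
  convert this using 1
  rw [eq_div_iff hb0, branch_ofReal]
  have hP' := congrArg (eval (x : ℂ)) hP
  have hS' := congrArg (eval (x : ℂ)) hS
  simp only [eval_mul, eval_add, eval_C, eval_ofNat, eval_polyDC_ofReal, ← hσ2] at hP' hS'
  rw [hP']
  field_simp
  linear_combination hS'

theorem IsSolution.log_sub_eq (h : IsSolution a b c P Q)
    (hP : derivative P = C (P.natDegree : ℂ) * (Q * S))
    (hS : 2 * C (P.natDegree : ℂ) * (P * S) =
      derivative (polyDC a b) * Q + 2 * polyDC a b * derivative Q)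
    (hLc : Continuous L) (hL : ∀ z, Complex.exp (L z) = branch a b P Q z) {A B : ℝ[X]}
    (hAB : S = A.map (algebraMap ℝ ℂ) + C Complex.I * B.map (algebraMap ℝ ℂ)) {e e' : ℝ}
    (he : Consecutive a b e e') {η : ℝ} (hη : η = 1 ∨ η = -1)
    (hs : ∀ x ∈ Set.Ioo e e', sqrtD a b x = η * csqrt ((polyD a b).eval x))
    (hA : IntervalIntegrable (integrand a b A) MeasureTheory.volume e e')
    (hB : IntervalIntegrable (integrand a b B) MeasureTheory.volume e e') :
    L e' - L e = η * P.natDegree *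
      ((∫ x in e..e', integrand a b A x) + Complex.I * ∫ x in e..e', integrand a b B x) := by
  rw [← intervalIntegral.integral_const_mul, ← intervalIntegral.integral_add hA (hB.const_mul _),
    ← intervalIntegral.integral_const_mul]
  refine (intervalIntegral.integral_eq_sub_of_hasDerivAt_of_le he.lt.le
    (f := fun t : ℝ => L t) (hLc.comp Complex.continuous_ofReal).continuousOn (fun x hx => ?_)
    ((hA.add (hB.const_mul _)).const_mul _)).symm
  refine (h.hasDerivAt_log hP hS hLc hL (he.ne_zero x hx)).congr_deriv ?_
  rw [hs x hx, hAB]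
  simp only [integrand, eval_add, eval_mul, eval_C, eval_map_ofReal]
  rcases hη with rfl | rfl
  · push_cast; ring
  · push_cast; rw [neg_one_mul, neg_one_mul, div_neg]; ring

theorem exists_eq_add_I_mul (p : ℂ[X]) :
    ∃ A B : ℝ[X], p = A.map (algebraMap ℝ ℂ) + C Complex.I * B.map (algebraMap ℝ ℂ) ∧
      (∀ n, A.coeff n = (p.coeff n).re) ∧ ∀ n, B.coeff n = (p.coeff n).im := by
  have key : ∀ φ : ℂ → ℝ, φ 0 = 0 → ∀ n,
      (∑ k ∈ Finset.range (p.natDegree + 1), monomial k (φ (p.coeff k))).coeff n =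
        φ (p.coeff n) := by
    intro φ hφ n
    simp only [finsetSum_coeff, coeff_monomial, Finset.sum_ite_eq', Finset.mem_range]
    split_ifs with h
    · rfl
    · rw [coeff_eq_zero_of_natDegree_lt (by omega), hφ]
  refine ⟨_, _, ?_, key Complex.re rfl, key Complex.im rfl⟩
  ext n
  simp only [coeff_add, coeff_C_mul, coeff_map, key Complex.re rfl, key Complex.im rfl]
  rw [mul_comm]
  exact (Complex.re_add_im _).symm

/-- The periods of `df / f` determine `S`. Over the gaps the real part of `S` has vanishing
integrals; over the bands the imaginary part has, hence it has a zero in each of the `g + 1` bands,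
and it vanishes. -/
theorem IsSolution.exists_canonical (h : IsSolution a b c P Q) (hab : Ordered a b)
    (hP : derivative P = C (P.natDegree : ℂ) * (Q * S))
    (hS : 2 * C (P.natDegree : ℂ) * (P * S) =
      derivative (polyDC a b) * Q + 2 * polyDC a b * derivative Q)
    (hSm : S.Monic) (hSd : S.natDegree = g)
    (hLc : Continuous L) (hL : ∀ z, Complex.exp (L z) = branch a b P Q z) :
    ∃ R : ℝ[X], IsCanonical a b R ∧ S = R.map (algebraMap ℝ ℂ) := by
  have hr : (P.natDegree : ℝ) ≠ 0 := Nat.cast_ne_zero.2 (by have := h.natDegree_eq; omega)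
  obtain ⟨A, B, hAB, hA, hB⟩ := exists_eq_add_I_mul S
  have hAd : A.natDegree ≤ g := natDegree_le_iff_coeff_eq_zero.2 fun n hn => by
    rw [hA, coeff_eq_zero_of_natDegree_lt (by omega), Complex.zero_re]
  have hAg : A.coeff g = 1 := by
    have : S.coeff g = 1 := by rw [← hSd]; exact hSm
    rw [hA, this, Complex.one_re]
  have hBd : B.natDegree ≤ g := natDegree_le_iff_coeff_eq_zero.2 fun n hn => by
    rw [hB, coeff_eq_zero_of_natDegree_lt (by omega), Complex.zero_im]
  have hη0 : ∀ {η : ℝ}, η = 1 ∨ η = -1 → η ≠ 0 := by rintro η (rfl | rfl) <;> norm_num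
  have hB0 : B = 0 := by
    have hroot : ∀ j, ∃ x ∈ Set.Ioo (a j) (b j), B.eval x = 0 := by
      intro j
      have hj := hab.consecutive_band j
      refine hj.exists_root hab ?_
      obtain ⟨η, hη, hs⟩ := hj.exists_sign
      obtain ⟨n, hn⟩ := h.exists_log_sub_eq hL hj.left hj.right
      have h1 := h.log_sub_eq hP hS hLc hL hAB hj hη hs (hab.intervalIntegrable_band A j)
        (hab.intervalIntegrable_band B j)
      change _ = _ * (imagHalfPeriod a b A j + _ * imagHalfPeriod a b B j) at h1
      rw [hn, hab.imagHalfPeriod_eq, hab.imagHalfPeriod_eq] at h1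
      have h2 := congrArg Complex.re h1
      simp [hη0 hη, hr] at h2
      exact h2
    choose x hx hx0 using hroot
    have hinj : Function.Injective x := by
      refine StrictMono.injective fun i j hij => ?_
      linarith [hab.b_lt_a hij, (hx i).2, (hx j).1]
    exact eq_zero_of_natDegree_lt_card_of_eval_eq_zero _ hinj hx0 (by simp; omega)
  have hSA : S = A.map (algebraMap ℝ ℂ) := by rw [hAB, hB0]; simp
  have hAm : A.Monic := monic_of_natDegree_le_of_coeff_eq_one g hAd hAg
  refine ⟨A, ⟨hAm, ?_, fun j => ?_⟩, hSA⟩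
  · rw [← hSd, hSA, hAm.natDegree_map]
  · have hj := hab.consecutive_gap j
    obtain ⟨η, hη, hs⟩ := hj.exists_sign
    obtain ⟨n, hn⟩ := h.exists_log_sub_eq hL hj.left hj.right
    have h1 := h.log_sub_eq hP hS hLc hL hAB hj hη hs (hab.intervalIntegrable_gap A j)
      (hab.intervalIntegrable_gap B j)
    change _ = _ * (realPeriod a b A j + _ * realPeriod a b B j) at h1
    rw [hn, hab.realPeriod_eq, hab.realPeriod_eq] at h1
    have h2 := congrArg Complex.re h1
    simp [hη0 hη, hr] at h2
    rw [hab.realPeriod_eq]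
    exact_mod_cast h2

/-! ### The change of argument -/

/-- On an interval where `D > 0`, the differential `df / f` is real. -/
theorem IsSolution.im_log_eq (h : IsSolution a b c P Q) {R : ℝ[X]}
    (hP : derivative P = C (P.natDegree : ℂ) * (Q * R.map (algebraMap ℝ ℂ)))
    (hS : 2 * C (P.natDegree : ℂ) * (P * R.map (algebraMap ℝ ℂ)) =
      derivative (polyDC a b) * Q + 2 * polyDC a b * derivative Q)
    (hLc : Continuous L) (hL : ∀ z, Complex.exp (L z) = branch a b P Q z) {u v : ℝ} (huv : u < v)
    (hD : ∀ x ∈ Set.Ioo u v, 0 < (polyD a b).eval x) : (L u).im = (L v).im := by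
  obtain ⟨x, hx, hx'⟩ := exists_hasDerivAt_eq_slope (fun t : ℝ => (L t).im)
    (fun x => (P.natDegree * (R.map (algebraMap ℝ ℂ)).eval (x : ℂ) / sqrtD a b x).im) huv
    (Complex.continuous_im.comp (hLc.comp Complex.continuous_ofReal)).continuousOn
    fun x hx => Complex.imCLM.hasFDerivAt.comp_hasDerivAt x
      (h.hasDerivAt_log hP hS hLc hL (hD x hx).ne')
  have him : (P.natDegree * (R.map (algebraMap ℝ ℂ)).eval (x : ℂ) / sqrtD a b x).im = 0 := by
    have h1 : sqrtD a b x = ((sqrtD a b x).re : ℂ) :=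
      Complex.ext rfl (by simpa using sqrtD_ofReal_im (hD x hx))
    rw [h1, eval_map_ofReal, ← Complex.ofReal_natCast, ← Complex.ofReal_mul, ← Complex.ofReal_div,
      Complex.ofReal_im]
  rw [him] at hx'
  have := (div_eq_zero_iff.1 hx'.symm).resolve_right (sub_pos.2 huv).ne'
  linarith

/-- The function `δ ^ r f(ζ / δ)` in homogeneous form, which makes sense for `δ = 0` also, and is
even in `δ`. -/
noncomputable def homogBranch (a b : Fin (g + 1) → ℝ) (P Q : ℂ[X]) (ζ : ℂ) (δ : ℝ) : ℂ :=
  homogEval P P.natDegree (foldUp ζ) (|δ| : ℝ) +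
    (∏ i, foldSqrt (ζ - (|δ| * a i : ℝ)) * foldSqrt (ζ - (|δ| * b i : ℝ))) *
      homogEval Q Q.natDegree (foldUp ζ) (|δ| : ℝ)

theorem homogBranch_of_pos (hd : P.natDegree = Q.natDegree + (g + 1)) (ζ : ℂ) {δ : ℝ}
    (hδ : 0 < δ) :
    homogBranch a b P Q ζ δ = δ ^ P.natDegree * branch a b P Q (ζ / δ) := by
  have hδ' : (δ : ℂ) ≠ 0 := Complex.ofReal_ne_zero.2 hδ.ne'
  have hfac : ∀ e : ℝ, foldSqrt (ζ - (δ * e : ℝ)) = (√δ : ℂ) * foldSqrt (ζ / δ - e) := by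
    intro e
    rw [← foldSqrt_ofReal_mul hδ.le, mul_sub, mul_div_cancel₀ _ hδ', Complex.ofReal_mul]
  have hsq : (√δ : ℂ) * (√δ : ℂ) = δ := by
    rw [← Complex.ofReal_mul, Real.mul_self_sqrt hδ.le]
  have hprod : (∏ i, foldSqrt (ζ - (δ * a i : ℝ)) * foldSqrt (ζ - (δ * b i : ℝ))) =
      (δ : ℂ) ^ (g + 1) * sqrtD a b (ζ / δ) := by
    have : (δ : ℂ) ^ (g + 1) = ∏ _i : Fin (g + 1), (δ : ℂ) := by simp
    rw [this, sqrtD, ← Finset.prod_mul_distrib]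
    refine Finset.prod_congr rfl fun i _ => ?_
    rw [hfac, hfac, ← hsq]
    ring
  rw [homogBranch, abs_of_pos hδ, homogEval_of_ne_zero le_rfl _ hδ',
    homogEval_of_ne_zero le_rfl _ hδ', hprod, branch, foldUp_div_ofReal _ hδ, hd, pow_add]
  ring

theorem homogBranch_zero (hP : P.Monic) (hQ : Q.Monic) (hd : P.natDegree = Q.natDegree + (g + 1))
    (ζ : ℂ) : homogBranch a b P Q ζ 0 = 2 * foldUp ζ ^ P.natDegree := by
  have h1 : P.coeff P.natDegree = 1 := hP
  have h2 : Q.coeff Q.natDegree = 1 := hQ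
  simp only [homogBranch, abs_zero, Complex.ofReal_zero, homogEval_zero, h1, h2, zero_mul, sub_zero,
    ← sq, foldSqrt_sq, Finset.prod_const, Finset.card_univ, Fintype.card_fin, one_mul]
  rw [hd]
  ring

theorem continuous_homogBranch (a b : Fin (g + 1) → ℝ) (P Q : ℂ[X]) :
    Continuous fun p : ℂ × ℝ => homogBranch a b P Q p.1 p.2 := by
  have h1 : ∀ R : ℂ[X],
      Continuous fun p : ℂ × ℝ => homogEval R R.natDegree (foldUp p.1) (|p.2| : ℝ) := fun R =>
    continuous_finsetSum _ fun k _ =>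
      (continuous_const.mul ((continuous_foldUp.comp continuous_fst).pow k)).mul
        ((Complex.continuous_ofReal.comp continuous_snd.abs).pow _)
  have h2 : ∀ e : ℝ, Continuous fun p : ℂ × ℝ => foldSqrt (p.1 - (|p.2| * e : ℝ)) := fun e =>
    continuous_foldSqrt.comp (continuous_fst.sub
      (Complex.continuous_ofReal.comp (continuous_snd.abs.mul continuous_const)))
  exact (h1 P).add ((continuous_finsetProd _ fun i _ => (h2 (a i)).mul (h2 (b i))).mul (h1 Q))

/-- Along a large half-circle the logarithm of `f` changes by about `π i r`, as `f ∼ 2 x ^ r`. -/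
theorem IsSolution.tendsto_log_sub (h : IsSolution a b c P Q) (hLc : Continuous L)
    (hL : ∀ z, Complex.exp (L z) = branch a b P Q z) :
    Tendsto (fun δ : ℝ => L ((-δ⁻¹ : ℝ) : ℂ) - L ((δ⁻¹ : ℝ) : ℂ)) (𝓝[>] 0)
      (𝓝 (P.natDegree * Real.pi * Complex.I)) := by
  have hd := h.natDegree_eq
  set ζ : ℝ → ℂ := fun θ => Complex.exp (θ * Complex.I) with hζ
  have hζc : Continuous ζ := by fun_prop
  have hζπ : ζ Real.pi = -1 := Complex.exp_pi_mul_I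
  have hζ0 : ζ 0 = 1 := by simp [hζ]
  have hne : ∀ (θ δ : ℝ), homogBranch a b P Q (ζ θ) δ ≠ 0 := by
    intro θ δ
    rcases eq_or_ne δ 0 with rfl | hδ
    · rw [homogBranch_zero h.2.1 h.2.2.1 hd]
      exact mul_ne_zero two_ne_zero (pow_ne_zero _ (foldUp_ne_zero (Complex.exp_ne_zero _)))
    · have heven : homogBranch a b P Q (ζ θ) δ = homogBranch a b P Q (ζ θ) |δ| := by
        simp only [homogBranch, abs_abs]
      rw [heven, homogBranch_of_pos hd _ (abs_pos.2 hδ)]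
      exact mul_ne_zero (pow_ne_zero _ (Complex.ofReal_ne_zero.2 (abs_pos.2 hδ).ne'))
        (h.branch_ne_zero _)
  have hcont : Continuous fun p : ℝ × ℝ => homogBranch a b P Q (ζ p.2) p.1 :=
    (continuous_homogBranch a b P Q).comp
      (f := fun p : ℝ × ℝ => (ζ p.2, p.1)) (by fun_prop)
  -- A logarithm of `δ ^ r f(ζ / δ)` that is continuous up to `δ = 0`, where the function is
  -- `2 ζ ^ r` on the upper half-circle: its change along the half-circle is continuous in `δ`.
  obtain ⟨M, hMc, hM⟩ := exists_continuous_log hcont fun p => hne p.2 p.1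
  have hpos : ∀ δ : ℝ, 0 < δ →
      L ((-δ⁻¹ : ℝ) : ℂ) - L ((δ⁻¹ : ℝ) : ℂ) = M (δ, Real.pi) - M (δ, 0) := by
    intro δ hδ
    have h1 := eq_of_exp_eq_const (s := Set.univ) isPreconnected_univ
      (h := fun θ : ℝ => M (δ, θ) - L (ζ θ / δ)) (k := δ ^ P.natDegree)
      (Continuous.continuousOn (by fun_prop))
      (fun θ _ => by
        rw [Complex.exp_sub, hM, hL, homogBranch_of_pos hd _ hδ,
          mul_div_cancel_right₀ _ (h.branch_ne_zero _)])
      (Set.mem_univ Real.pi) (Set.mem_univ 0)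
    simp only [hζπ, hζ0] at h1
    have h2 : ((-δ⁻¹ : ℝ) : ℂ) = -1 / δ := by push_cast; field_simp
    have h3 : ((δ⁻¹ : ℝ) : ℂ) = 1 / δ := by push_cast; field_simp
    rw [h2, h3]
    linear_combination -h1
  have hzero : M (0, Real.pi) - M (0, 0) = P.natDegree * Real.pi * Complex.I := by
    have h1 := eq_of_exp_eq_const (s := Set.Icc 0 Real.pi) isPreconnected_Icc
      (h := fun θ : ℝ => M (0, θ) - P.natDegree * (θ * Complex.I)) (k := 2)
      (Continuous.continuousOn (by fun_prop))
      (fun θ hθ => by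
        have him : 0 ≤ (ζ θ).im := by
          rw [hζ]
          simp only [Complex.exp_ofReal_mul_I_im]
          exact Real.sin_nonneg_of_mem_Icc hθ
        rw [Complex.exp_sub, hM, homogBranch_zero h.2.1 h.2.2.1 hd, foldUp_of_nonneg him,
          Complex.exp_nat_mul,
          mul_div_cancel_right₀ _ (pow_ne_zero _ (Complex.exp_ne_zero _))])
      (Set.right_mem_Icc.2 Real.pi_pos.le) (Set.left_mem_Icc.2 Real.pi_pos.le)
    simp only [Complex.ofReal_zero, zero_mul, mul_zero, sub_zero] at h1
    linear_combination h1
  have hlim : Tendsto (fun δ : ℝ => M (δ, Real.pi) - M (δ, 0)) (𝓝[>] 0)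
      (𝓝 (M (0, Real.pi) - M (0, 0))) :=
    (Continuous.tendsto (by fun_prop) 0).mono_left nhdsWithin_le_nhds
  rw [hzero] at hlim
  refine hlim.congr' ?_
  filter_upwards [self_mem_nhdsWithin] with δ hδ using (hpos δ hδ).symm

/-- The imaginary part of `L` is constant on both outer half-lines, so the asymptotic change along
large half-circles is attained exactly at the extreme branch points. -/
theorem IsSolution.im_log_sub_eq (h : IsSolution a b c P Q) (hab : Ordered a b) {R : ℝ[X]}
    (hP : derivative P = C (P.natDegree : ℂ) * (Q * R.map (algebraMap ℝ ℂ)))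
    (hS : 2 * C (P.natDegree : ℂ) * (P * R.map (algebraMap ℝ ℂ)) =
      derivative (polyDC a b) * Q + 2 * polyDC a b * derivative Q)
    (hLc : Continuous L) (hL : ∀ z, Complex.exp (L z) = branch a b P Q z) :
    (L (a 0)).im - (L (b (Fin.last g))).im = P.natDegree * Real.pi := by
  have hlim := (Complex.continuous_im.tendsto _).comp (h.tendsto_log_sub hLc hL)
  have hconst : (fun δ : ℝ => (L ((-δ⁻¹ : ℝ) : ℂ) - L ((δ⁻¹ : ℝ) : ℂ)).im) =ᶠ[𝓝[>] 0]
      fun _ => (L (a 0)).im - (L (b (Fin.last g))).im := by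
    filter_upwards [tendsto_inv_nhdsGT_zero.eventually_gt_atTop (-a 0),
      tendsto_inv_nhdsGT_zero.eventually_gt_atTop (b (Fin.last g))] with δ h1 h2
    rw [Complex.sub_im, h.im_log_eq hP hS hLc hL (u := -δ⁻¹) (v := a 0) (by linarith)
      fun x hx => hab.eval_polyD_pos_of_lt hx.2,
      ← h.im_log_eq hP hS hLc hL h2 fun x hx => hab.eval_polyD_pos_of_gt hx.1]
  have h3 := tendsto_nhds_unique (tendsto_const_nhds.congr' hconst.symm) hlim
  rw [h3]
  simp

/-- The numbers `r |η_j| / π` are positive integers with sum `r`: over the bands, the argument of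
`f` on the upper half-plane decreases by `r |η_j|`, over the gaps it does not change, and over the
whole real line it decreases by `π r`. -/
theorem IsSolution.exists_natCast_eq (h : IsSolution a b c P Q) (hab : Ordered a b) {R : ℝ[X]}
    (hR : IsCanonical a b R)
    (hP : derivative P = C (P.natDegree : ℂ) * (Q * R.map (algebraMap ℝ ℂ)))
    (hS : 2 * C (P.natDegree : ℂ) * (P * R.map (algebraMap ℝ ℂ)) =
      derivative (polyDC a b) * Q + 2 * polyDC a b * derivative Q)
    (hLc : Continuous L) (hL : ∀ z, Complex.exp (L z) = branch a b P Q z) :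
    ∃ n : Fin (g + 1) → ℕ,
      (∀ j, 0 < n j ∧ (n j : ℝ) = P.natDegree * ‖imagHalfPeriod a b R j‖ / Real.pi) ∧
        ∑ j, n j = P.natDegree := by
  have hπ := Real.pi_pos
  have hr : (0 : ℝ) < P.natDegree := Nat.cast_pos.2 (by have := h.natDegree_eq; omega)
  obtain ⟨ρ, hρ, hRρ⟩ := hR.exists_eq_prod hab
  have hRS : R.map (algebraMap ℝ ℂ) = R.map (algebraMap ℝ ℂ) +
      C Complex.I * (0 : ℝ[X]).map (algebraMap ℝ ℂ) := by simp
  have hz : ∀ x, integrand a b 0 x = 0 := fun x => by simp [integrand]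
  have hband : ∀ j, 0 < ‖imagHalfPeriod a b R j‖ ∧
      L (b j) - L (a j) = -(P.natDegree * ‖imagHalfPeriod a b R j‖ : ℝ) * Complex.I := by
    intro j
    have hj := hab.consecutive_band j
    obtain ⟨η, hη, hs⟩ := hj.exists_sign
    have h1 := h.log_sub_eq hP hS hLc hL hRS hj hη hs (hab.intervalIntegrable_band R j)
      (hab.intervalIntegrable_band 0 j)
    change _ = _ * (imagHalfPeriod a b R j + _) at h1
    simp only [hz, intervalIntegral.integral_zero, mul_zero, add_zero] at h1
    have hηR : ∀ x ∈ Set.Ioo (a j) (b j), 0 < (C η * R).eval x := by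
      intro x hx
      obtain ⟨m, hm, hmx⟩ := hab.exists_sqrtD_eq hρ hx
      rw [← hRρ, hs x hx, csqrt_of_nonpos (hab.eval_polyD_neg hx).le] at hmx
      have h2 : η * √|(polyD a b).eval x| = m * R.eval x := by
        have h3 : Complex.I * ((η * √|(polyD a b).eval x| : ℝ) : ℂ) =
            Complex.I * ((m * R.eval x : ℝ) : ℂ) := by
          rw [← hmx]; push_cast; ring
        exact_mod_cast mul_left_cancel₀ Complex.I_ne_zero h3
      have h4 : 0 < √|(polyD a b).eval x| :=
        Real.sqrt_pos.2 (abs_pos.2 (hab.eval_polyD_neg hx).ne)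
      rw [eval_mul, eval_C]
      have h5 : m * (η * R.eval x) = √|(polyD a b).eval x| := by
        have h6 : η * η = 1 := by rcases hη with rfl | rfl <;> norm_num
        linear_combination (-η) * h2 + √|(polyD a b).eval x| * h6
      exact pos_of_mul_pos_right (by rw [h5]; exact h4) hm.le
    have hpos := hj.integral_pos hab hηR
    simp only [eval_mul, eval_C, mul_div_assoc] at hpos
    rw [intervalIntegral.integral_const_mul] at hpos
    rw [hab.imagHalfPeriod_eq] at h1 ⊢
    set J := ∫ x in (a j)..(b j), R.eval x / √|(polyD a b).eval x| with hJ
    have hnorm : ‖-Complex.I * (J : ℂ)‖ = η * J := by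
      rw [norm_mul, norm_neg, Complex.norm_I, one_mul, Complex.norm_real, Real.norm_eq_abs]
      rcases hη with rfl | rfl
      · rw [one_mul] at hpos ⊢
        exact abs_of_pos hpos
      · rw [neg_one_mul] at hpos ⊢
        exact abs_of_neg (neg_pos.1 hpos)
    rw [hnorm]
    refine ⟨hpos, h1.trans ?_⟩
    push_cast
    ring
  have hgap : ∀ j : Fin g, L (a j.succ) = L (b j.castSucc) := by
    intro j
    have hj := hab.consecutive_gap j
    obtain ⟨η, hη, hs⟩ := hj.exists_sign
    have h1 := h.log_sub_eq hP hS hLc hL hRS hj hη hs (hab.intervalIntegrable_gap R j)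
      (hab.intervalIntegrable_gap 0 j)
    change _ = _ * (realPeriod a b R j + _) at h1
    simp only [hz, intervalIntegral.integral_zero, mul_zero, add_zero, hR.2.2 j] at h1
    exact sub_eq_zero.1 h1
  have hint : ∀ j, ∃ n : ℕ, 0 < n ∧
      (n : ℝ) = P.natDegree * ‖imagHalfPeriod a b R j‖ / Real.pi := by
    intro j
    obtain ⟨k, hk⟩ := h.exists_log_sub_eq hL (eval_polyD_a a b j) (eval_polyD_b a b j)
    have h1 := congrArg Complex.im (hk.symm.trans (hband j).2)
    simp at h1
    have h2 : 0 < P.natDegree * ‖imagHalfPeriod a b R j‖ := mul_pos hr (hband j).1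
    have h3 : k < 0 := by
      by_contra! h3
      have : (0 : ℝ) ≤ k * Real.pi := mul_nonneg (Int.cast_nonneg h3) hπ.le
      linarith
    obtain ⟨m, hm⟩ := Int.eq_ofNat_of_zero_le (neg_nonneg.2 h3.le)
    refine ⟨m, by omega, ?_⟩
    have h4 : (m : ℝ) = -k := by exact_mod_cast hm.symm
    rw [eq_div_iff hπ.ne', h4]
    linarith
  choose n hn hn' using hint
  refine ⟨n, fun j => ⟨hn j, hn' j⟩, ?_⟩
  have hsum : ∑ j, (L (b j) - L (a j)) = L (b (Fin.last g)) - L (a 0) := by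
    rw [Finset.sum_sub_distrib, Fin.sum_univ_castSucc, Fin.sum_univ_succ (fun j => L (a j))]
    simp only [hgap]
    ring
  have htot := h.im_log_sub_eq hab hP hS hLc hL
  have h5 : ∑ j, -(P.natDegree * ‖imagHalfPeriod a b R j‖) = -(P.natDegree * Real.pi) := by
    rw [← htot, neg_sub, ← Complex.sub_im, ← hsum, Complex.im_sum]
    refine Finset.sum_congr rfl fun j _ => ?_
    rw [(hband j).2]
    simp
  have h6 : ((∑ j, n j : ℕ) : ℝ) = P.natDegree := by
    push_cast
    simp only [hn']
    rw [← Finset.sum_div, div_eq_iff hπ.ne']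
    rw [Finset.sum_neg_distrib] at h5
    linarith
  exact_mod_cast h6

end Log

/-! ### The zeros of the canonical differential -/

/-- Each of the `g` zeros of `R` lies in a gap, where `D ≠ 0`, so there are two points of the curve
above it. -/
theorem IsCanonical.exists_zeros (hab : Ordered a b) {R : ℝ[X]} (hR : IsCanonical a b R) :
    ∃ Z : Finset (Curve a b), Z.card = 2 * g ∧ (∀ p ∈ Z, HasOrderAt (eta R) p 1) ∧
      ∀ p ∉ Z, p ≠ .inftyPlus → p ≠ .inftyMinus → HasOrderAt (eta R) p 0 := by
  obtain ⟨ρ, hρ, hRρ⟩ := hR.exists_eq_prod hab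
  have hinj := (hab.strictMono_of_mem_gap hρ).injective
  have hmap : R.map (algebraMap ℝ ℂ) = ∏ k, (X - C (ρ k : ℂ)) := by
    rw [hRρ, Polynomial.map_prod]
    simp
  have hσ : ∀ j, sqrtD a b (ρ j) ^ 2 = (polyDC a b).eval (ρ j : ℂ) := fun j => by
    rw [sqrtD_sq, foldUp_ofReal]
  have hσ0 : ∀ j, sqrtD a b (ρ j) ≠ 0 := by
    intro j h0
    have h1 := sqrtD_ofReal_sq a b (ρ j)
    rw [h0] at h1
    exact (hab.eval_polyD_pos (hρ j)).ne' (by simpa using h1.symm)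
  let pt : Fin g × ℤˣ → Curve a b := fun q =>
    .affine (ρ q.1) (((q.2 : ℤ) : ℂ) * sqrtD a b (ρ q.1)) (by
      rcases Int.units_eq_one_or q.2 with h | h <;> simp [h, hσ])
  have hpt : Function.Injective pt := by
    rintro ⟨i, s⟩ ⟨j, t⟩ h
    simp only [pt, Curve.affine.injEq, Complex.ofReal_inj] at h
    obtain rfl := hinj h.1
    have h2 := mul_right_cancel₀ (hσ0 i) h.2
    exact Prod.ext rfl (Units.ext (by exact_mod_cast h2))
  refine ⟨Finset.univ.map ⟨pt, hpt⟩, by simp [mul_comm], fun p hp => ?_, fun p hp h1 h2 => ?_⟩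
  · obtain ⟨⟨j, s⟩, -, rfl⟩ := Finset.mem_map.1 hp
    have hE : (∏ k ∈ Finset.univ.erase j, (X - C (ρ k : ℂ))).eval (ρ j : ℂ) ≠ 0 := by
      rw [eval_prod, Finset.prod_ne_zero_iff]
      intro k hk
      simp only [eval_sub, eval_X, eval_C, sub_ne_zero, ne_eq, Complex.ofReal_inj]
      exact fun h => Finset.ne_of_mem_erase hk (hinj h).symm
    refine hasOrderAt_affine_of_ne_zero hab _ ?_ (k := 1) hE ?_
    · refine mul_ne_zero ?_ (hσ0 j)
      exact_mod_cast s.ne_zero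
    · rw [hmap, pow_one]
      exact (Finset.mul_prod_erase _ (fun k => X - C (ρ k : ℂ)) (Finset.mem_univ j)).symm
  · cases p with
    | inftyPlus => exact absurd rfl h1
    | inftyMinus => exact absurd rfl h2
    | affine x₀ y₀ h₀ =>
      have hR0 : (R.map (algebraMap ℝ ℂ)).eval x₀ ≠ 0 := by
        intro h0
        rw [hmap, eval_prod, Finset.prod_eq_zero_iff] at h0
        obtain ⟨j, -, hj⟩ := h0
        have hx : x₀ = ρ j := by simpa [sub_eq_zero] using hj
        subst hx
        refine hp (Finset.mem_map.2 ?_)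
        rcases sq_eq_sq_iff_eq_or_eq_neg.1 (h₀.trans (hσ j).symm) with h | h
        · exact ⟨(j, 1), Finset.mem_univ _, by simp [pt, h]⟩
        · exact ⟨(j, -1), Finset.mem_univ _, by simp [pt, h]⟩
      by_cases hy : y₀ = 0
      · exact hasOrderAt_affine_zero hab h₀ hy hR0
      · exact hasOrderAt_affine_of_ne_zero hab h₀ hy (k := 0) hR0 (by simp)

end PellAbel

theorem proposition2p5 {g : ℕ} (a b : Fin (g + 1) → ℝ) (hab : PellAbel.Ordered a b)
    (c : ℂ) (P Q : ℂ[X]) (hPQ : PellAbel.IsSolution a b c P Q)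
    (r : ℕ) (hr : P.natDegree = r) :
    -- the canonical polynomial `R` exists and is unique; `η = (R / y) dx`
    ∃ R : ℝ[X], PellAbel.IsCanonical a b R ∧ (∀ R', PellAbel.IsCanonical a b R' → R' = R) ∧
      -- `df / f = r η` for `f = P + y Q`
      PellAbel.DlogEq a b (fun x y => P.eval x + y * Q.eval x)
        (fun x y => (r : ℂ) * PellAbel.eta R x y) ∧
      -- (i) `2 g` simple zeros, two simple poles, no other zeros and poles; the residues
      (∃ Z : Finset (PellAbel.Curve a b), Z.card = 2 * g ∧
        (∀ p ∈ Z, PellAbel.HasOrderAt (PellAbel.eta R) p 1) ∧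
        PellAbel.HasOrderAt (PellAbel.eta R) (.inftyPlus : PellAbel.Curve a b) (-1) ∧
        PellAbel.HasOrderAt (PellAbel.eta R) (.inftyMinus : PellAbel.Curve a b) (-1) ∧
        (∀ p ∉ Z, p ≠ .inftyPlus → p ≠ .inftyMinus →
          PellAbel.HasOrderAt (PellAbel.eta R) p 0)) ∧
      PellAbel.HasResidueAt (PellAbel.eta R) (.inftyPlus : PellAbel.Curve a b) (-1) ∧
      PellAbel.HasResidueAt (PellAbel.eta R) (.inftyMinus : PellAbel.Curve a b) 1 ∧
      -- (ii) the real periods of `η` vanish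
      (∀ j : Fin g,
        IntervalIntegrable (PellAbel.integrand a b R) MeasureTheory.volume
          (b j.castSucc) (a j.succ) ∧
        PellAbel.realPeriod a b R j = 0) ∧
      -- (iii) the `r |η_j| / π` are positive integers with sum `r`
      (∀ j : Fin (g + 1),
        IntervalIntegrable (PellAbel.integrand a b R) MeasureTheory.volume (a j) (b j)) ∧
      ∃ n : Fin (g + 1) → ℕ,
        (∀ j, 0 < n j ∧ (n j : ℝ) = r * ‖PellAbel.imagHalfPeriod a b R j‖ / Real.pi) ∧
        ∑ j, n j = r := by
  obtain ⟨S, hSm, hSd, hPS, hS⟩ := hPQ.exists_derivative_eq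
  obtain ⟨L, hLc, hL⟩ := PellAbel.exists_continuous_log (PellAbel.continuous_branch a b P Q)
    hPQ.branch_ne_zero
  obtain ⟨R, hR, rfl⟩ := hPQ.exists_canonical hab hPS hS hSm hSd hLc hL
  obtain ⟨Z, hZ, hZ1, hZ0⟩ := hR.exists_zeros hab
  have h1 : (1 : ℂ) ^ 2 = 1 := one_pow 2
  have h2 : (-1 : ℂ) ^ 2 = 1 := neg_one_sq
  subst hr
  exact ⟨R, hR, fun R' hR' => hR.unique hab hR', hPQ.dlogEq hab hS hPS,
    ⟨Z, hZ, hZ1,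
      ⟨PellAbel.exists_isParamInfty h1 a b,
        fun x y hp => PellAbel.hasOrderAt_infty h1 hR.1 hR.2.1 hp⟩,
      ⟨PellAbel.exists_isParamInfty h2 a b,
        fun x y hp => PellAbel.hasOrderAt_infty h2 hR.1 hR.2.1 hp⟩, hZ0⟩,
    ⟨PellAbel.exists_isParamInfty h1 a b,
      fun x y hp => PellAbel.hasResidueAt_infty h1 hR.1 hR.2.1 hp⟩,
    ⟨PellAbel.exists_isParamInfty h2 a b, fun x y hp => by
      simpa using PellAbel.hasResidueAt_infty h2 hR.1 hR.2.1 hp⟩,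
    fun j => ⟨hab.intervalIntegrable_gap R j, hR.2.2 j⟩,
    hab.intervalIntegrable_band R, hPQ.exists_natCast_eq hab hR hPS hS hLc hL⟩
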